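/- Let $G$ be a finite group. For a subset $S\subseteq G$ with $S^{-1}=S$ and $1\notin S$, the Cayley graph $\mathrm{Cay}(G,S)$ has vertex set $G$ and edge set $\{\{g,sg\}: g\in G,\ s\in S\}$; it is cubic if every vertex has exactly three neighbours, and integral if all eigenvalues of its adjacency matrix are integers. An involution is an element of order $2$. Consider the condition $(\ast)$ $G\cong S_3$, or for every involution $x$ and every element $y$ of $G$ the subgroup $\langle x,y\rangle$ is isomorphic to one of $$\mathbb{Z}_2,\ \mathbb{Z}_2^2,\ \mathbb{Z}_4,\ \mathbb{Z}_6,\ \mathbb{Z}_2\times\mathbb{Z}_4,\ \mathbb{Z}_2\times\mathbb{Z}_6,\ A_4 .$$ Then: 1. Every cubic Cayley graph of $G$ is integral if and only if $(\ast)$ holds. (Both sides hold vacuously if $|G|$ is odd.) 2. $G$ has at least one cubic Cayley graph and every cubic Cayley graph of $G$ is integral if and only if $|G|$ is even, $|G|>2$ and $(\ast)$ holds. -/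

import Mathlib

/-- The Cayley graph `Cay(G, S)` of a symmetric subset `S` not containing the identity: the vertex
set is `G` and the edges are the pairs `{g, s * g}` with `g ∈ G` and `s ∈ S`. -/
def cayleyGraph {G : Type*} [Group G] (S : Set G) (hS : S⁻¹ = S) (h1 : (1 : G) ∉ S) :
    SimpleGraph G where
  Adj g h := ∃ s ∈ S, h = s * g
  symm := ⟨by
    rintro g h ⟨s, hs, rfl⟩
    refine ⟨s⁻¹, ?_, by simp⟩
    rw [← hS]
    simpa using hs⟩
  loopless := ⟨by
    rintro g ⟨s, hs, h⟩
    have h' : s = 1 := by simpa using h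
    exact h1 (h' ▸ hs)⟩

/-- Every vertex of the graph has exactly `k` neighbours (used for finite graphs and `k ≠ 0`). -/
def HasValency {V : Type*} (Γ : SimpleGraph V) (k : ℕ) : Prop :=
  ∀ v : V, (Γ.neighborSet v).ncard = k

open Classical in
/-- A finite graph is integral if all eigenvalues of its adjacency matrix are integers. (The
adjacency matrix is real symmetric, so all its eigenvalues are real.) -/
def IsIntegralGraph {V : Type*} [Fintype V] (Γ : SimpleGraph V) : Prop :=
  ∀ μ : ℝ, Module.End.HasEigenvalue (Matrix.toLin' (Γ.adjMatrix ℝ)) μ → ∃ n : ℤ, μ = (n : ℝ)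

/-- All Cayley graphs of `G` with valency `k` are integral. -/
def AllCayleyIntegral (k : ℕ) (G : Type*) [Group G] [Fintype G] : Prop :=
  ∀ (S : Set G) (hS : S⁻¹ = S) (h1 : (1 : G) ∉ S),
    HasValency (cayleyGraph S hS h1) k → IsIntegralGraph (cayleyGraph S hS h1)

/-- `G` has at least one Cayley graph with valency `k`. -/
def HasCayleyOfValency (k : ℕ) (G : Type*) [Group G] : Prop :=
  ∃ (S : Set G) (hS : S⁻¹ = S) (h1 : (1 : G) ∉ S), HasValency (cayleyGraph S hS h1) k

/-- `H` is isomorphic to one of `ℤ₂, ℤ₂², ℤ₄, ℤ₆, ℤ₂ × ℤ₄, ℤ₂ × ℤ₆, A₄`. -/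
def IsListed (H : Type*) [Group H] : Prop :=
  Nonempty (H ≃* Multiplicative (ZMod 2)) ∨
  Nonempty (H ≃* Multiplicative (ZMod 2 × ZMod 2)) ∨
  Nonempty (H ≃* Multiplicative (ZMod 4)) ∨
  Nonempty (H ≃* Multiplicative (ZMod 6)) ∨
  Nonempty (H ≃* Multiplicative (ZMod 2 × ZMod 4)) ∨
  Nonempty (H ≃* Multiplicative (ZMod 2 × ZMod 6)) ∨
  Nonempty (H ≃* alternatingGroup (Fin 4))

/-- `G ≅ S₃`, or `⟨x, y⟩` is in the above list for every involution `x` and every `y` in `G`. -/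
def IsSymmThreeOrPairsListed (G : Type*) [Group G] : Prop :=
  Nonempty (G ≃* Equiv.Perm (Fin 3)) ∨
    ∀ x y : G, orderOf x = 2 → IsListed (Subgroup.closure ({x, y} : Set G))

/-!
The adjacency operator of `Cay(G, S)` is left multiplication by `∑ s ∈ S, s` on the real group
algebra (`isIntegralGraph_cayleyGraph_iff`), so integrality of the graph can be refuted by a nonzero
vector of the group algebra on which this element satisfies a quadratic equation with real but
nonintegral roots (`HasIntegralSpectrum.exists_root`). Such vectors are written down explicitly as
products of factors `1 ± g`, which project to suitable characters of subgroups, and no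
representation theory is needed. A cubic connection set is either `{x, y, y⁻¹}` with `x` an
involution, or a set of three involutions.

Suppose that all cubic Cayley graphs of `G` are integral. The vector `∑ cos (2 π k / n) y ^ k`, with
`n` the order of `y`, is an eigenvector of `y + y⁻¹`; whenever an involution acts as `±1` on a
suitable multiple of it, `2 cos (2 π / n)` is an integer, which leaves `n = 3, 4, 6`. In particular elements of even order have order `2`, `4` or `6`
(`orderOf_of_even`), and the product of two involutions has order at most three
(`involutions_mul_pow`).

If two involutions `x`, `y` do not commute, then `x`, `y`, `x y x` are the only involutions
(`involution_eq`) and only the identity centralizes `x` and `y` (`eq_one_of_commute_pair`), so the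
conjugation action on the three involutions identifies `G` with the symmetric group of degree three.

If all involutions commute, then for an involution `x` and any `y` either `x` and `y` commute and the
order of `y` divides `4` or `6`, or `y ^ 3 = (x y) ^ 3 = 1` (`orderOf_of_odd`,
`mul_pow_three_eq_one`, `commute_of_pow_four`, `commute_of_pow_six`). These relations
(`PairRelation`) hold exactly when `⟨x, y⟩` is one of the listed groups; the last two force the
alternating group of degree four, realized on the cosets of `⟨y⟩`
(`nonempty_mulEquiv_alternatingGroup`).

Conversely, the relations make the spectrum integral. If `x` commutes with `y + y⁻¹`, the eigenvalues
are `±1` plus those of `y + y⁻¹`, which are integers as `y ^ 4 = 1` or `y ^ 6 = 1`; in the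
alternating case a quadratic relation for `(1 + y + y⁻¹) x` determines them
(`hasIntegralSpectrum_of_cube`). Three commuting involutions are diagonalized simultaneously, and the
three transpositions of the symmetric group of degree three give the complete bipartite graph.
-/

open MonoidAlgebra

/-! ### Eigenvalues in the group algebra -/

/-- An element `a` of the real group algebra has integral spectrum if every real eigenvalue of left
multiplication by `a` is an integer. -/
def HasIntegralSpectrum {G : Type*} [Group G] (a : MonoidAlgebra ℝ G) : Prop :=
  ∀ (μ : ℝ) (f : MonoidAlgebra ℝ G), f ≠ 0 → a * f = μ • f → ∃ n : ℤ, μ = (n : ℝ)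

section Dictionary

variable {G : Type*} [Group G]

theorem coeff_sum_of_mul (S : Finset G) (f : MonoidAlgebra ℝ G) (g : G) :
    ((∑ s ∈ S, of ℝ G s) * f).coeff g = ∑ s ∈ S, f.coeff (s⁻¹ * g) := by
  simp [Finset.sum_mul, of_apply]

theorem neighborSet_cayleyGraph (S : Set G) (hS : S⁻¹ = S) (h1 : (1 : G) ∉ S) (g : G) :
    (cayleyGraph S hS h1).neighborSet g = (fun s => s * g) '' S := by
  ext h
  constructor
  · rintro ⟨s, hs, rfl⟩
    exact ⟨s, hs, rfl⟩
  · rintro ⟨s, hs, rfl⟩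
    exact ⟨s, hs, rfl⟩

theorem hasValency_cayleyGraph_iff (S : Set G) (hS : S⁻¹ = S) (h1 : (1 : G) ∉ S) (k : ℕ) :
    HasValency (cayleyGraph S hS h1) k ↔ S.ncard = k := by
  have h : ∀ g : G, ((cayleyGraph S hS h1).neighborSet g).ncard = S.ncard := fun g => by
    rw [neighborSet_cayleyGraph, Set.ncard_image_of_injective _ (mul_left_injective g)]
  exact ⟨fun hv => (h 1).symm.trans (hv 1), fun hk g => (h g).trans hk⟩

open Classical in
/-- The adjacency operator of `Cay(G, S)` is left multiplication by `∑ s ∈ S, s` on the group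
algebra, because `S` is closed under inversion. -/
theorem adjMatrix_cayleyGraph_mulVec [Fintype G] (S : Finset G) (hS : (S : Set G)⁻¹ = S)
    (h1 : (1 : G) ∉ (S : Set G)) (f : MonoidAlgebra ℝ G) (g : G) :
    (((cayleyGraph (S : Set G) hS h1).adjMatrix ℝ).mulVec f.coeff) g =
      ((∑ s ∈ S, of ℝ G s) * f).coeff g := by
  rw [SimpleGraph.adjMatrix_mulVec_apply, coeff_sum_of_mul]
  symm
  refine Finset.sum_bij (fun s _ => s⁻¹ * g) ?_ ?_ ?_ ?_
  · intro s hs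
    rw [SimpleGraph.mem_neighborFinset]
    refine ⟨s⁻¹, ?_, rfl⟩
    rw [← hS]
    simpa using hs
  · intro a _ b _ h
    simpa using h
  · intro b hb
    rw [SimpleGraph.mem_neighborFinset] at hb
    obtain ⟨s, hs, rfl⟩ := hb
    refine ⟨s⁻¹, ?_, by simp⟩
    rw [← hS] at hs
    simpa using hs
  · intro _ _
    rfl

theorem isIntegralGraph_cayleyGraph_iff [Fintype G] (S : Finset G) (hS : (S : Set G)⁻¹ = S)
    (h1 : (1 : G) ∉ (S : Set G)) :
    IsIntegralGraph (cayleyGraph (S : Set G) hS h1) ↔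
      HasIntegralSpectrum (∑ s ∈ S, of ℝ G s) := by
  classical
  constructor
  · intro h μ f hf hμ
    refine h μ ?_
    refine Module.End.hasEigenvalue_of_hasEigenvector (x := (f.coeff : G → ℝ)) ⟨?_, ?_⟩
    · rw [Module.End.mem_eigenspace_iff, Matrix.toLin'_apply]
      funext g
      have := adjMatrix_cayleyGraph_mulVec S hS h1 f g
      rw [hμ, coeff_smul, Finsupp.coe_smul] at this
      convert this using 1
    · intro h0
      apply hf
      ext g
      simpa using congrFun h0 g
  · intro h μ hμ
    obtain ⟨v, hv, hv0⟩ := hμ.exists_hasEigenvector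
    rw [Module.End.mem_eigenspace_iff, Matrix.toLin'_apply] at hv
    let f : MonoidAlgebra ℝ G := ofCoeff (Finsupp.equivFunOnFinite.symm v)
    have hfv : (f.coeff : G → ℝ) = v := by
      funext g
      simp [f]
    refine h μ f ?_ ?_
    · intro h0
      apply hv0
      rw [← hfv, h0]
      rfl
    · ext g
      rw [← adjMatrix_cayleyGraph_mulVec S hS h1 f g, hfv]
      have := congrFun hv g
      simp only [coeff_smul, Finsupp.smul_apply, hfv]
      rw [Pi.smul_apply] at this
      convert this using 1

theorem HasIntegralSpectrum.of_allCayleyIntegral [Fintype G] (h : AllCayleyIntegral 3 G)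
    (S : Finset G) (hS : (S : Set G)⁻¹ = S) (h1 : (1 : G) ∉ S) (hc : S.card = 3) :
    HasIntegralSpectrum (∑ s ∈ S, of ℝ G s) :=
  (isIntegralGraph_cayleyGraph_iff S hS (by simpa using h1)).1
    (h S hS (by simpa using h1) ((hasValency_cayleyGraph_iff _ _ _ _).2 (by simpa using hc)))

/-- The connection set `{x, y, y⁻¹}` with `x` an involution and `y` of order at least three. -/
theorem hasIntegralSpectrum_pair [Fintype G] (h : AllCayleyIntegral 3 G) {x y : G}
    (hx : x * x = 1) (hx1 : x ≠ 1) (hy : y * y ≠ 1) :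
    HasIntegralSpectrum (of ℝ G x + of ℝ G y + of ℝ G y⁻¹) := by
  classical
  have hxi : x⁻¹ = x := inv_eq_of_mul_eq_one_left hx
  have hyy : y ≠ y⁻¹ := fun e => hy (by nth_rewrite 2 [e]; simp)
  have hxy : x ≠ y := by rintro rfl; exact hy hx
  have hxy' : x ≠ y⁻¹ := fun e => hxy (by rw [← hxi, e, inv_inv])
  have hy1 : y ≠ 1 := by rintro rfl; simp at hy
  have := HasIntegralSpectrum.of_allCayleyIntegral h {x, y, y⁻¹}
    (by simp [Set.inv_insert, hxi, Set.pair_comm])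
    (by simp [hx1.symm, hy1.symm, hy1]) (Finset.card_eq_three.2 ⟨x, y, y⁻¹, hxy, hxy', hyy, rfl⟩)
  rw [Finset.sum_insert (by simp [hxy, hxy']), Finset.sum_pair hyy, ← add_assoc] at this
  exact this

theorem hasIntegralSpectrum_triple [Fintype G] (h : AllCayleyIntegral 3 G) {x y z : G}
    (hx : x * x = 1) (hx1 : x ≠ 1) (hy : y * y = 1) (hy1 : y ≠ 1) (hz : z * z = 1) (hz1 : z ≠ 1)
    (hxy : x ≠ y) (hxz : x ≠ z) (hyz : y ≠ z) :
    HasIntegralSpectrum (of ℝ G x + of ℝ G y + of ℝ G z) := by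
  classical
  have := HasIntegralSpectrum.of_allCayleyIntegral h {x, y, z}
    (by simp [Set.inv_insert, inv_eq_of_mul_eq_one_left hx, inv_eq_of_mul_eq_one_left hy,
      inv_eq_of_mul_eq_one_left hz])
    (by simp [hx1.symm, hy1.symm, hz1.symm]) (Finset.card_eq_three.2 ⟨x, y, z, hxy, hxz, hyz, rfl⟩)
  rw [Finset.sum_insert (by simp [hxy, hxz]), Finset.sum_pair hyz, ← add_assoc] at this
  exact this

/-- If `a` has integral spectrum and acts on a nonzero vector as a root of the real-rooted
polynomial `T ^ 2 - p * T - q`, then this polynomial has an integer root. -/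
theorem HasIntegralSpectrum.exists_root {a f : MonoidAlgebra ℝ G} (h : HasIntegralSpectrum a)
    {p q : ℝ} (hf : f ≠ 0) (hD : 0 ≤ p ^ 2 + 4 * q) (haf : a * (a * f) = p • (a * f) + q • f) :
    ∃ k : ℤ, (k : ℝ) ^ 2 = p * k + q := by
  obtain ⟨d, hd⟩ : ∃ d : ℝ, d ^ 2 = p ^ 2 + 4 * q := ⟨√(p ^ 2 + 4 * q), Real.sq_sqrt hD⟩
  by_cases hg : a * f = ((p - d) / 2) • f
  · obtain ⟨k, hk⟩ := h _ f hf hg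
    exact ⟨k, by rw [← hk]; linear_combination hd / 4⟩
  · obtain ⟨k, hk⟩ := h ((p + d) / 2) (a * f - ((p - d) / 2) • f) (sub_ne_zero.2 hg) (by
      rw [mul_sub, haf, mul_smul_comm, smul_sub, smul_smul,
        show (p + d) / 2 * ((p - d) / 2) = -q by linear_combination - hd / 4]
      module)
    exact ⟨k, by rw [← hk]; linear_combination hd / 4⟩

/-- All eigenvectors below are shown to be nonzero by means of their coefficient at the identity. -/
theorem ne_zero_of_coeff_one {f : MonoidAlgebra ℝ G} (h : 0 < f.coeff 1) : f ≠ 0 := by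
  rintro rfl
  simp at h

end Dictionary

/-! ### Orders of elements and cosine sums -/

section Cosine

variable {G : Type*} [Group G]

/-- The element `∑ k < n, cos (2 π k / n) y ^ k` with `n` the order of `y`: an eigenvector of
`y + y⁻¹` with eigenvalue `2 cos (2 π / n)`. -/
noncomputable def cosElt (y : G) : MonoidAlgebra ℝ G :=
  ∑ k ∈ Finset.range (orderOf y),
    Real.cos (k * (2 * Real.pi / orderOf y)) • of ℝ G (y ^ k)

theorem sum_range_shift {A : Type*} [AddCommGroup A] {n : ℕ} (g : ℕ → A) (h : g n = g 0) :
    ∑ k ∈ Finset.range n, g (k + 1) = ∑ k ∈ Finset.range n, g k := by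
  have := Finset.sum_range_succ' g n
  rw [Finset.sum_range_succ, h] at this
  exact (add_right_cancel this).symm

theorem mul_cosElt [Finite G] (y : G) :
    (of ℝ G y + of ℝ G y⁻¹) * cosElt y =
      (2 * Real.cos (2 * Real.pi / orderOf y)) • cosElt y := by
  have hn : (orderOf y : ℝ) ≠ 0 := by exact_mod_cast (orderOf_pos y).ne'
  set θ : ℝ := 2 * Real.pi / orderOf y with hθ
  have hper : (orderOf y : ℝ) * θ = 2 * Real.pi := by rw [hθ]; field_simp
  have h1 : of ℝ G y * cosElt y =
      ∑ k ∈ Finset.range (orderOf y), Real.cos (k * θ - θ) • of ℝ G (y ^ k) := by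
    rw [← sum_range_shift]
    · rw [cosElt, Finset.mul_sum]
      refine Finset.sum_congr rfl fun k _ => ?_
      rw [mul_smul_comm, ← map_mul, pow_succ']
      congr 2
      push_cast
      ring
    · rw [hper, pow_orderOf_eq_one]
      simp [Real.cos_two_pi_sub]
  have h2 : of ℝ G y⁻¹ * cosElt y =
      ∑ k ∈ Finset.range (orderOf y), Real.cos (k * θ + θ) • of ℝ G (y ^ k) := by
    have := sum_range_shift (n := orderOf y)
      (fun k : ℕ => Real.cos (k * θ) • of ℝ G (y⁻¹ * y ^ k)) (by
        rw [hper, pow_orderOf_eq_one]; simp)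
    rw [cosElt, Finset.mul_sum]
    simp only [mul_smul_comm, ← map_mul, ← hθ]
    rw [← this]
    refine Finset.sum_congr rfl fun k _ => ?_
    rw [pow_succ', inv_mul_cancel_left]
    congr 2
    push_cast
    ring
  rw [add_mul, h1, h2, ← Finset.sum_add_distrib, cosElt, Finset.smul_sum]
  refine Finset.sum_congr rfl fun k _ => ?_
  rw [← add_smul, smul_smul, Real.cos_sub, Real.cos_add]
  congr 1
  ring

theorem coeff_cosElt_pow (y : G) {m : ℕ} (hm : m < orderOf y) :
    (cosElt y).coeff (y ^ m) = Real.cos (m * (2 * Real.pi / orderOf y)) := by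
  classical
  rw [cosElt, coeff_sum, Finset.sum_apply', Finset.sum_eq_single m]
  · simp [of_apply]
  · intro k hk hkm
    have : y ^ k ≠ y ^ m := fun e => hkm (pow_injOn_Iio_orderOf (by simpa using hk) hm e)
    simp [of_apply, this]
  · intro h
    exact absurd (Finset.mem_range.2 hm) h

theorem coeff_cosElt_one [Finite G] (y : G) : (cosElt y).coeff 1 = 1 := by
  simpa using coeff_cosElt_pow y (m := 0) (orderOf_pos y)

theorem coeff_cosElt_of_notMem {y g : G} (hg : g ∉ Subgroup.zpowers y) :
    (cosElt y).coeff g = 0 := by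
  classical
  rw [cosElt, coeff_sum, Finset.sum_apply']
  refine Finset.sum_eq_zero fun k _ => ?_
  have : y ^ k ≠ g := fun e => hg (e ▸ Subgroup.npow_mem_zpowers y k)
  simp [of_apply, this]

/-- `2 cos (2 π / n)` lies strictly between consecutive integers unless `n` is `3`, `4` or `6`. -/
theorem eq_of_two_cos_eq_int {n : ℕ} (hn : 3 ≤ n) {k : ℤ}
    (h : 2 * Real.cos (2 * Real.pi / n) = k) : n = 3 ∨ n = 4 ∨ n = 6 := by
  have hpi := Real.pi_pos
  by_contra! hc
  rcases (show n = 5 ∨ 7 ≤ n by omega) with rfl | h7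
  · have h1 : 0 < Real.cos (2 * Real.pi / (5 : ℕ)) :=
      Real.cos_pos_of_mem_Ioo ⟨by push_cast; linarith, by push_cast; linarith⟩
    have h2 : Real.cos (2 * Real.pi / (5 : ℕ)) < 1 / 2 := by
      rw [← Real.cos_pi_div_three]
      exact Real.cos_lt_cos_of_nonneg_of_le_pi (by linarith) (by push_cast; linarith)
        (by push_cast; linarith)
    have h3 : (0 : ℝ) < k := by linarith
    have h4 : (k : ℝ) < 1 := by linarith
    norm_cast at h3 h4
    omega
  · have hn7 : (7 : ℝ) ≤ n := by exact_mod_cast h7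
    have hpos : 0 < 2 * Real.pi / n := by positivity
    have hlt : 2 * Real.pi / n < Real.pi / 3 := by
      rw [div_lt_div_iff₀ (by linarith) (by norm_num)]
      nlinarith
    have h1 : 1 / 2 < Real.cos (2 * Real.pi / n) := by
      rw [← Real.cos_pi_div_three]
      exact Real.cos_lt_cos_of_nonneg_of_le_pi hpos.le (by linarith) hlt
    have h2 : Real.cos (2 * Real.pi / n) < 1 := by
      rw [← Real.cos_zero]
      exact Real.cos_lt_cos_of_nonneg_of_le_pi le_rfl (by linarith) hpos
    have h3 : (1 : ℝ) < k := by linarith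
    have h4 : (k : ℝ) < 2 := by linarith
    norm_cast at h3 h4
    omega

theorem three_le_orderOf [Finite G] {y : G} (hy : y * y ≠ 1) : 3 ≤ orderOf y := by
  have h0 := orderOf_pos y
  have h1 : orderOf y ≠ 1 := fun e => hy (by rw [orderOf_eq_one_iff.1 e, one_mul])
  have h2 : orderOf y ≠ 2 := fun e => hy (by rw [← pow_two, ← e, pow_orderOf_eq_one])
  omega

/-- If `x` acts as an integer scalar on an eigenvector of `y + y⁻¹` with eigenvalue
`2 cos (2 π / n)`, where `n` is the order of `y`, then integrality of `Cay(G, {x, y, y⁻¹})`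
restricts `n`. -/
theorem orderOf_eq_of_eigenvector [Fintype G] (h : AllCayleyIntegral 3 G) {x y : G}
    (hx : x * x = 1) (hx1 : x ≠ 1) (hy : y * y ≠ 1) {v : MonoidAlgebra ℝ G} (hv : v ≠ 0)
    (hyv : (of ℝ G y + of ℝ G y⁻¹) * v = (2 * Real.cos (2 * Real.pi / orderOf y)) • v)
    {ε : ℤ} (hxv : of ℝ G x * v = (ε : ℝ) • v) :
    orderOf y = 3 ∨ orderOf y = 4 ∨ orderOf y = 6 := by
  obtain ⟨k, hk⟩ := hasIntegralSpectrum_pair h hx hx1 hy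
    (ε + 2 * Real.cos (2 * Real.pi / orderOf y)) _ hv (by
      rw [add_assoc, add_mul, hxv, hyv, ← add_smul])
  refine eq_of_two_cos_eq_int (three_le_orderOf hy) (k := k - ε) ?_
  push_cast
  linarith

/-- The case in which `x` commutes with `y + y⁻¹`: project the cosine eigenvector to the
eigenspace of `x` for `ε = ±1`. -/
theorem orderOf_eq_of_commute [Fintype G] (h : AllCayleyIntegral 3 G) {x y : G}
    (hx : x * x = 1) (hx1 : x ≠ 1) (hy : y * y ≠ 1)
    (hxy : Commute (of ℝ G x) (of ℝ G y + of ℝ G y⁻¹)) {ε : ℤ} (hε : ε * ε = 1)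
    (hpos : 0 < 1 + ε * (cosElt y).coeff x) :
    orderOf y = 3 ∨ orderOf y = 4 ∨ orderOf y = 6 := by
  have hε' : (ε : ℝ) * ε = 1 := by exact_mod_cast hε
  refine orderOf_eq_of_eigenvector (ε := ε) h hx hx1 hy
    (v := cosElt y + (ε : ℝ) • (of ℝ G x * cosElt y)) ?_ ?_ ?_
  · apply ne_zero_of_coeff_one
    rw [coeff_add, coeff_smul, Finsupp.add_apply, Finsupp.smul_apply, of_apply,
      coeff_single_mul_apply, coeff_cosElt_one, inv_eq_of_mul_eq_one_left hx, mul_one, one_mul]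
    exact hpos
  · rw [mul_add, mul_smul_comm, ← mul_assoc _ (of ℝ G x), ← hxy.eq, mul_assoc (of ℝ G x),
      mul_cosElt, mul_smul_comm, smul_add, smul_comm]
  · rw [mul_add, mul_smul_comm, ← mul_assoc, ← map_mul, hx, map_one, one_mul, smul_add, smul_smul,
      hε', one_smul, add_comm]

/-- An element of even order has order `2`, `4` or `6`. -/
theorem orderOf_of_even [Fintype G] (h : AllCayleyIntegral 3 G) {y : G}
    (he : Even (orderOf y)) : orderOf y = 2 ∨ orderOf y = 4 ∨ orderOf y = 6 := by
  by_cases hy : y * y = 1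
  · left
    have h1 : orderOf y ∣ 2 := orderOf_dvd_of_pow_eq_one (by rw [pow_two, hy])
    rcases (Nat.dvd_prime Nat.prime_two).1 h1 with h | h
    · rw [h] at he
      exact absurd he (by decide)
    · exact h
  obtain ⟨m, hm⟩ := he
  have h3 := three_le_orderOf hy
  have hmn : m < orderOf y := by omega
  have hx : y ^ m * y ^ m = 1 := by rw [← pow_add, ← hm, pow_orderOf_eq_one]
  have hx1 : y ^ m ≠ 1 := pow_ne_one_of_lt_orderOf (by omega) hmn
  have hcomm : Commute (of ℝ G (y ^ m)) (of ℝ G y + of ℝ G y⁻¹) :=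
    (((Commute.refl y).pow_left m).map (of ℝ G)).add_right
      (((Commute.refl y).inv_right.pow_left m).map (of ℝ G))
  have := orderOf_eq_of_commute h hx hx1 hy hcomm (ε := -1) (by norm_num) (by
    have hcos : Real.cos (m * (2 * Real.pi / orderOf y)) = -1 := by
      rw [← Real.cos_pi]
      congr 1
      have : (orderOf y : ℝ) = m + m := by exact_mod_cast hm
      have hm0 : (m : ℝ) ≠ 0 := by
        have : m ≠ 0 := by omega
        exact_mod_cast this
      rw [this]
      field_simp
      ring
    rw [coeff_cosElt_pow y hmn, hcos]
    norm_num)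
  omega

end Cosine

/-! ### Products of two involutions -/

section Dihedral

/-- For involutions `x` and `y`, a central element `t` acting as `-1`, and `x y + y x` acting as the
scalar `j`, the element `a = x + y + t` satisfies `a ^ 2 + 2 a = 1 + j` on the given vector. -/
theorem sq_apply_of_neg_one {A : Type*} [Ring A] [Algebra ℝ A] {x y t f : A} (hx : x * x = 1)
    (hy : y * y = 1) (htx : Commute t x) (hty : Commute t y) (ht : t * f = -f) {j : ℝ}
    (hf : (x * y + y * x) * f = j • f) :
    (x + y + t) * ((x + y + t) * f) = (-2 : ℝ) • ((x + y + t) * f) + (1 + j) • f := by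
  have h1 : (x + y + t) * f = (x + y) * f - f := by rw [add_mul _ t, ht, sub_eq_add_neg]
  have h2 : t * ((x + y) * f) = -((x + y) * f) := by
    rw [← mul_assoc, (htx.add_right hty).eq, mul_assoc, ht, mul_neg]
  have h3 : (x + y) * ((x + y) * f) = (2 + j) • f := by
    have : (x + y) * ((x + y) * f) = (x * x) * f + (y * y) * f + (x * y + y * x) * f := by
      noncomm_ring
    rw [this, hx, hy, hf, one_mul]
    module
  rw [h1, mul_sub, h1, add_mul _ t, h2, h3]
  module

variable {G : Type*} [Group G]

/-- The product of two involutions has order at most three. Its order is restricted to `3`, `4`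
and `6` by the prism `{x, r, r⁻¹}`, where `r = x y`; the orders `4` and `6` are excluded by the
connection set `{x, y, t}` with `t` the central involution of the dihedral group `⟨x, y⟩`. -/
theorem involutions_mul_pow [Fintype G] (h : AllCayleyIntegral 3 G) {x y : G}
    (hx : x * x = 1) (hy : y * y = 1) : (x * y) ^ 2 = 1 ∨ (x * y) ^ 3 = 1 := by
  by_contra! hc
  obtain ⟨h2, h3⟩ := hc
  have hxi : x⁻¹ = x := inv_eq_of_mul_eq_one_left hx
  have hyi : y⁻¹ = y := inv_eq_of_mul_eq_one_left hy
  have hx1 : x ≠ 1 := by rintro rfl; simp [pow_two, hy] at h2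
  have hy1 : y ≠ 1 := by rintro rfl; simp [pow_two, hx] at h2
  have hX : of ℝ G x * of ℝ G x = 1 := by rw [← map_mul, hx, map_one]
  have hY : of ℝ G y * of ℝ G y = 1 := by rw [← map_mul, hy, map_one]
  obtain ⟨r, hr⟩ : ∃ r, r = x * y := ⟨_, rfl⟩
  have hri : r⁻¹ = y * x := by rw [hr, mul_inv_rev, hxi, hyi]
  rw [← hr] at h2 h3
  have hxr : x * r * x = r⁻¹ := by rw [hri, hr, ← mul_assoc, hx, one_mul]
  have hyr : y * r * y = r⁻¹ := by rw [hri, hr, mul_assoc, mul_assoc, hy, mul_one]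
  have hxmem : x ∉ Subgroup.zpowers r := by
    rintro ⟨k, hk⟩
    have hc : Commute x r := by
      rw [← hk]
      exact (Commute.refl r).zpow_left k
    rw [hc.eq, mul_assoc, hx, mul_one] at hxr
    exact h2 (by rw [pow_two]; nth_rewrite 2 [hxr]; simp)
  have hymem : y ∉ Subgroup.zpowers r := by
    intro hy'
    apply hxmem
    have : x = r * y := by rw [hr, mul_assoc, hy, mul_one]
    rw [this]
    exact mul_mem (Subgroup.mem_zpowers r) hy'
  have hsum : of ℝ G x * of ℝ G y + of ℝ G y * of ℝ G x = of ℝ G r + of ℝ G r⁻¹ := by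
    rw [hri, hr, map_mul, map_mul]
  have hcomm : Commute (of ℝ G x) (of ℝ G r + of ℝ G r⁻¹) := by
    rw [← hsum]
    show _ * _ = _ * _
    simp only [mul_add, add_mul, mul_assoc, hX, mul_one]
    rw [← mul_assoc, hX, one_mul, add_comm]
  have hxy : x ≠ y := by
    rintro rfl
    rw [hx] at hr
    simp [hr] at h2
  -- `x + y + t` acts on `f` as a root of `T ^ 2 + 2 T - (1 + j)`
  have key : ∀ t : G, t ∈ Subgroup.zpowers r → t * t = 1 → t ≠ 1 → Commute t x → Commute t y →
      ∀ (f : MonoidAlgebra ℝ G) (j : ℝ), f ≠ 0 → 0 ≤ 2 + j → of ℝ G t * f = -f →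
      (of ℝ G r + of ℝ G r⁻¹) * f = j • f → ∃ k : ℤ, (k : ℝ) ^ 2 = -2 * k + (1 + j) := by
    intro t ht htt ht1 htx hty f j hf hj htf hrf
    have hint := hasIntegralSpectrum_triple h hx hx1 hy hy1 htt ht1 hxy
      (by rintro rfl; exact hxmem ht) (by rintro rfl; exact hymem ht)
    refine hint.exists_root hf (by linarith) ?_
    exact sq_apply_of_neg_one hX hY (htx.map (of ℝ G)) (hty.map (of ℝ G)) htf (by rw [hsum, hrf])
  have hconj : ∀ (n : ℕ), r ^ n * r ^ n = 1 → Commute (r ^ n) x ∧ Commute (r ^ n) y := by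
    intro n hn
    have hinv : (r⁻¹) ^ n = r ^ n := by rw [inv_pow]; exact inv_eq_of_mul_eq_one_left hn
    have hz : ∀ z : G, z * z = 1 → z * r * z = r⁻¹ → Commute (r ^ n) z := by
      intro z hzz hzr
      have hs : SemiconjBy z r r⁻¹ := by rw [SemiconjBy, ← hzr, mul_assoc, hzz, mul_one]
      have := hs.pow_right n
      rw [hinv] at this
      exact Commute.symm this
    exact ⟨hz x hx hxr, hz y hy hyr⟩
  rcases orderOf_eq_of_commute h hx hx1 (by rwa [← pow_two]) hcomm (ε := 1) (by norm_num)
    (by rw [coeff_cosElt_of_notMem hxmem]; norm_num) with hn | hn | hn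
  · exact h3 (hn ▸ pow_orderOf_eq_one r)
  -- order four: `r + r⁻¹` vanishes where `r ^ 2 = -1`, and `k ^ 2 + 2 k = 1` has no integer root
  · have h4 : r ^ 2 * r ^ 2 = 1 := by rw [← pow_add, ← pow_orderOf_eq_one r, hn]
    obtain ⟨k, hk⟩ := key (r ^ 2) (Subgroup.npow_mem_zpowers r 2) h4 h2 (hconj 2 h4).1
      (hconj 2 h4).2 (1 - of ℝ G (r ^ 2)) 0 
      (by
        apply ne_zero_of_coeff_one
        simp [-map_pow, of_apply, one_def, h2]) (by norm_num)
      (by rw [mul_sub, ← map_mul, h4, map_one]; noncomm_ring)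
      (by
        have hi : r⁻¹ = r ^ 3 := inv_eq_of_mul_eq_one_left (by rw [← pow_succ, ← h4, ← pow_add])
        have h4' := congrArg (of ℝ G) h4
        rw [hi, zero_smul]
        simp only [map_mul, map_pow, map_one] at h4' ⊢
        linear_combination (norm := noncomm_ring) -of ℝ G r * h4')
    have hk' : k ^ 2 = -2 * k + 1 := by exact_mod_cast (by simpa using hk : (k : ℝ) ^ 2 = -2 * k + 1)
    have : k ≤ 1 := by nlinarith
    have : -3 ≤ k := by nlinarith
    interval_cases k <;> omega
  -- order six: `r + r⁻¹ = 1` where `r ^ 2 - r + 1 = 0`, and `k ^ 2 + 2 k = 2` has no integer root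
  · have h6 : r ^ 3 * r ^ 3 = 1 := by rw [← pow_add, ← pow_orderOf_eq_one r, hn]
    obtain ⟨k, hk⟩ := key (r ^ 3) (Subgroup.npow_mem_zpowers r 3) h6 h3 (hconj 3 h6).1
      (hconj 3 h6).2 ((1 - of ℝ G (r ^ 3)) * (1 + of ℝ G r)) 1
      (by
        apply ne_zero_of_coeff_one
        have hr1 : r ≠ 1 := by rintro e; simp [e] at h2
        have hr4 : r ^ 3 * r ≠ 1 := by
          rw [← pow_succ]
          exact pow_ne_one_of_lt_orderOf (by norm_num) (by omega)
        simp only [sub_mul, mul_add, one_mul, mul_one, ← map_mul]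
        simp [-map_pow, of_apply, one_def, h3, hr1, hr4]) (by norm_num)
      (by rw [← mul_assoc, mul_sub, ← map_mul, h6, map_one]; noncomm_ring)
      (by
        have hi : r⁻¹ = r ^ 5 := inv_eq_of_mul_eq_one_left (by rw [← pow_succ, ← h6, ← pow_add])
        have h6' := congrArg (of ℝ G) h6
        rw [hi, one_smul]
        simp only [map_mul, map_pow, map_one] at h6' ⊢
        linear_combination (norm := noncomm_ring) (1 - of ℝ G r ^ 2 - of ℝ G r ^ 3) * h6')
    have hk' : k ^ 2 = -2 * k + 2 := by
      have : (k : ℝ) ^ 2 = -2 * k + 2 := by linarith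
      exact_mod_cast this
    have : k ≤ 1 := by nlinarith
    have : -3 ≤ k := by nlinarith
    interval_cases k <;> omega

end Dihedral

/-! ### Noncommuting involutions -/

section SymmetricThree

theorem mul_mul_self_cancel {G : Type*} [Group G] {x : G} (hx : x * x = 1) (w : G) :
    x * (x * w) = w := by
  rw [← mul_assoc, hx, one_mul]

/-- For noncommuting involutions `x`, `y` with `(x y) ^ 3 = 1` and a commuting `c` of order three,
`(x + y c + y c⁻¹) ^ 2` acts as the scalar `3` on `(1 - c) (1 - x y)`. -/
theorem sq_apply_of_central {A : Type*} [Ring A] {x y c : A} (hx : x * x = 1) (hy : y * y = 1)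
    (hc : c * c * c = 1) (hxc : x * c = c * x) (hyc : y * c = c * y)
    (hxy : y * x = x * y * (x * y)) :
    (x + y * c + y * (c * c)) * ((x + y * c + y * (c * c)) * ((1 - c) * (1 - x * y))) =
      3 * ((1 - c) * (1 - x * y)) := by
  have h1 : (x + y * c + y * (c * c)) * (1 - c) = (1 - c) * (x - y) := by
    have : (x + y * c + y * (c * c)) * (1 - c) = x - x * c + y * c - y * (c * c * c) := by
      noncomm_ring
    rw [this, hc, hxc, hyc]
    noncomm_ring
  have h2 : (x - y) * ((x - y) * (1 - x * y)) = 3 * (1 - x * y) := by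
    have : (x - y) * ((x - y) * (1 - x * y)) =
        x * x + y * y - x * y - y * x - x * x * (x * y) - y * y * (x * y) + x * y * (x * y)
          + y * (x * x) * y := by
      noncomm_ring
    rw [this, hx, mul_one, hy, ← hxy]
    noncomm_ring
  rw [← mul_assoc _ (1 - c), h1, mul_assoc (1 - c), ← mul_assoc _ (1 - c), h1, mul_assoc (1 - c),
    h2]
  noncomm_ring

/-- If the involution `x` inverts the commuting elements `a` and `b` of order three, then
`(x + x a + x b) ^ 2` acts as the scalar `3` on `(1 + a + a ^ 2) (1 - b)`. -/
theorem sq_apply_of_inverts {A : Type*} [Ring A] {x a b : A} (hx : x * x = 1)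
    (ha : a * a * a = 1) (hb : b * b * b = 1) (hab : a * b = b * a)
    (hxa : x * a = a * a * x) (hxb : x * b = b * b * x) :
    (x + x * a + x * b) * ((x + x * a + x * b) * ((1 + a + a * a) * (1 - b))) =
      3 * ((1 + a + a * a) * (1 - b)) := by
  have hN : a * (1 + a + a * a) = 1 + a + a * a := by
    have : a * (1 + a + a * a) = a + a * a + a * a * a := by noncomm_ring
    rw [this, ha]
    abel
  have hN' : b * (1 + a + a * a) = (1 + a + a * a) * b := by
    have hc : Commute b a := hab.symm
    exact ((Commute.one_right b).add_right hc).add_right (hc.mul_right hc)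
  have h0 : (x + x * a + x * b) * (x + x * a + x * b) =
      (1 + a * a + b * b) * (1 + a + b) := by
    have : (x + x * a + x * b) * (x + x * a + x * b) =
        (x + x * a + x * b) * x * (1 + a + b) := by noncomm_ring
    rw [this, hxa, hxb]
    have : (x + a * a * x + b * b * x) * x = (1 + a * a + b * b) * (x * x) := by noncomm_ring
    rw [this, hx, mul_one]
  have h1 : (1 + a + b) * (1 + a + a * a) = (1 + a + a * a) * (2 + b) := by
    rw [add_mul, hN', add_mul, hN]
    noncomm_ring
  have h2 : (1 + a * a + b * b) * (1 + a + a * a) = (1 + a + a * a) * (2 + b * b) := by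
    rw [add_mul, mul_assoc b, hN', ← mul_assoc b, hN', add_mul, mul_assoc a, hN, hN]
    noncomm_ring
  have h3 : (2 + b * b) * ((2 + b) * (1 - b)) = 3 * (1 - b) := by
    have : (2 + b * b) * ((2 + b) * (1 - b)) = 4 - 2 * b - b * b * b - b * b * b * b := by
      have h4 : (4 : A) = 2 * 2 := by norm_num
      rw [h4]
      noncomm_ring
    have h4 : (4 : A) = 3 + 1 := by norm_num
    have hb3 : (3 : A) * b = 2 * b + b := by rw [← two_add_one_eq_three, add_mul, one_mul]
    rw [this, hb, h4, one_mul, mul_sub, mul_one, hb3]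
    abel
  rw [← mul_assoc, h0, mul_assoc, ← mul_assoc _ _ (1 - b), h1, mul_assoc _ _ (1 - b),
    ← mul_assoc _ (1 + a + a * a), h2, mul_assoc, h3]
  noncomm_ring

variable {G : Type*} [Group G]

theorem not_sq_eq_three (k : ℤ) : (k : ℝ) ^ 2 ≠ 3 := by
  intro h
  have h' : k ^ 2 = 3 := by exact_mod_cast h
  have : k ≤ 2 := by nlinarith
  have : -2 ≤ k := by nlinarith
  interval_cases k <;> omega

theorem HasIntegralSpectrum.eq_zero_of_sq_apply {a f : MonoidAlgebra ℝ G}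
    (h : HasIntegralSpectrum a) (haf : a * (a * f) = 3 * f) : f = 0 := by
  by_contra hf
  obtain ⟨k, hk⟩ := h.exists_root (p := 0) (q := 3) hf (by norm_num) (by
    rw [haf, zero_smul, zero_add, ← Nat.cast_ofNat (R := MonoidAlgebra ℝ G),
      ← nsmul_eq_mul]
    module)
  exact not_sq_eq_three k (by linarith)

/-- No element of order three centralizes two noncommuting involutions. -/
theorem eq_one_of_commute_involutions [Fintype G] (h : AllCayleyIntegral 3 G) {x y c : G}
    (hx : x * x = 1) (hy : y * y = 1) (hxy : (x * y) ^ 3 = 1) (hne : x ≠ y)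
    (hc : c ^ 3 = 1) (hxc : Commute x c) (hyc : Commute y c) : c = 1 := by
  by_contra hc1
  have hr1 : x * y ≠ 1 := fun e => hne ((eq_inv_of_mul_eq_one_left e).trans
    (inv_eq_of_mul_eq_one_left hy))
  have hx1 : x ≠ 1 := by
    rintro rfl
    rw [one_mul, pow_succ, pow_two, hy, one_mul] at hxy
    exact hne hxy.symm
  have hcc : c * c * c = 1 := by rw [← hc, pow_succ, pow_two]
  have hw : (y * c) * (y * c) = c * c := by
    rw [hyc.symm.mul_mul_mul_comm, hy, one_mul]
  have hw1 : (y * c) * (y * c) ≠ 1 := by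
    intro e
    rw [hw] at e
    rw [e, one_mul] at hcc
    exact hc1 hcc
  have hwi : (y * c)⁻¹ = y * (c * c) := by
    apply inv_eq_of_mul_eq_one_right
    rw [hyc.symm.mul_mul_mul_comm, hy, one_mul, ← mul_assoc, hcc]
  have hyx : y * x = x * y * (x * y) := by
    have : (x * y) * (x * y) = (x * y)⁻¹ :=
      eq_inv_of_mul_eq_one_left (by rw [← hxy, pow_succ, pow_two])
    rw [this, mul_inv_rev, inv_eq_of_mul_eq_one_left hx, inv_eq_of_mul_eq_one_left hy]
  have hint := hasIntegralSpectrum_pair h hx hx1 hw1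
  rw [hwi] at hint
  simp only [map_mul] at hint
  have := hint.eq_zero_of_sq_apply (sq_apply_of_central (x := of ℝ G x) (y := of ℝ G y)
    (c := of ℝ G c) (by rw [← map_mul, hx, map_one]) (by rw [← map_mul, hy, map_one])
    (by rw [← map_mul, ← map_mul, hcc, map_one]) (by rw [← map_mul, hxc.eq, map_mul])
    (by rw [← map_mul, hyc.eq, map_mul]) (by simp only [← map_mul]; rw [hyx]))
  refine ne_zero_of_coeff_one ?_ this
  simp only [sub_mul, mul_sub, one_mul, mul_one, ← map_mul]
  classical
  simp only [of_apply, one_def, coeff_sub, coeff_single, Finsupp.sub_apply, Finsupp.single_apply,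
    hr1, hc1, if_true, if_false]
  split_ifs <;> norm_num

/-- The cubes of `a b` and `a b⁻¹` are, up to `b ^ 3 = 1`, the products of `a` and its two conjugates
by `b` in the two possible orders; so `a` commutes with its conjugates by `b`. -/
theorem commute_conj_of_cube {a b : G} (hb : b ^ 3 = 1) (hab : (a * b) ^ 3 = 1)
    (hab' : (a * b⁻¹) ^ 3 = 1) :
    Commute a (b * a * b⁻¹) ∧ (b⁻¹ * a * b)⁻¹ = a * (b * a * b⁻¹) := by
  have hbb : b * b = b⁻¹ := eq_inv_of_mul_eq_one_left (by rw [← hb, pow_succ, pow_two])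
  have hbb' : b⁻¹ * b⁻¹ = b := by rw [← mul_inv_rev, hbb, inv_inv]
  have h1 : a * ((b * a * b⁻¹) * (b⁻¹ * a * b)) = 1 := by
    have : a * ((b * a * b⁻¹) * (b⁻¹ * a * b)) = a * b * a * (b⁻¹ * b⁻¹) * a * b := by
      simp only [mul_assoc]
    rw [this, hbb', ← hab]
    simp only [pow_succ, pow_zero, one_mul, mul_assoc]
  have h2 : a * ((b⁻¹ * a * b) * (b * a * b⁻¹)) = 1 := by
    have : a * ((b⁻¹ * a * b) * (b * a * b⁻¹)) = a * b⁻¹ * a * (b * b) * a * b⁻¹ := by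
      simp only [mul_assoc]
    rw [this, hbb, ← hab']
    simp only [pow_succ, pow_zero, one_mul, mul_assoc]
  have h3 : Commute (b * a * b⁻¹) (b⁻¹ * a * b) := mul_left_cancel (h1.trans h2.symm)
  refine ⟨?_, ?_⟩
  · have ha : a = ((b * a * b⁻¹) * (b⁻¹ * a * b))⁻¹ := eq_inv_of_mul_eq_one_left h1
    have := ((Commute.refl _).mul_left h3.symm).inv_left
    rwa [← ha] at this
  · rw [← mul_assoc] at h1
    exact inv_eq_of_mul_eq_one_left h1

theorem braid_of_cube {x y : G} (hx : x * x = 1) (hy : y * y = 1) (hxy : (x * y) ^ 3 = 1) :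
    x * y * x = y * x * y := by
  have h : (x * y * x) * (y * x * y) = 1 := by
    rw [← hxy]
    simp only [pow_succ, pow_zero, one_mul, mul_assoc]
  rw [eq_inv_of_mul_eq_one_left h]
  simp only [mul_inv_rev, inv_eq_of_mul_eq_one_left hx, inv_eq_of_mul_eq_one_left hy, mul_assoc]

theorem commute_of_sq {x y : G} (hx : x * x = 1) (hy : y * y = 1) (hxy : (x * y) ^ 2 = 1) :
    Commute x y := by
  have h : (x * y) * (x * y) = 1 := by rw [← pow_two, hxy]
  show x * y = y * x
  rw [eq_inv_of_mul_eq_one_left h, mul_inv_rev, inv_eq_of_mul_eq_one_left hx,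
    inv_eq_of_mul_eq_one_left hy]

theorem not_commute_conj {x y : G} (hx : x * x = 1) (hxy : ¬ Commute x y) :
    ¬ Commute (x * y * x) x := by
  intro e
  apply hxy
  have e' : x * y * x * x = x * (x * y * x) := e
  rw [mul_assoc (x * y), hx, mul_one, mul_assoc x y x, mul_mul_self_cancel hx] at e'
  exact e'

/-- If `x y` and `y z` have order three and `z ≠ x` commutes with `x`, then `x`, `y`, `z` satisfy
the Coxeter relations of the symmetric group of degree four, whose Coxeter element
`x y z = (x z) (z y z)` is a product of two involutions and has order four. -/
theorem eq_of_commute_left [Fintype G] (h : AllCayleyIntegral 3 G) {x y z : G}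
    (hx : x * x = 1) (hy : y * y = 1) (hz : z * z = 1) (hxy : (x * y) ^ 3 = 1)
    (hxz : Commute x z) (hyz : (y * z) ^ 3 = 1) : z = x := by
  have hw2 : (x * y * z) ^ 2 = y * (x * z) * y := by
    calc (x * y * z) ^ 2 = x * y * (z * x) * y * z := by simp only [pow_two, mul_assoc]
      _ = (x * y * x) * (z * y * z) := by rw [← hxz.eq]; simp only [mul_assoc]
      _ = (y * x * y) * (y * z * y) := by
        rw [braid_of_cube hx hy hxy, braid_of_cube hy hz hyz]
      _ = y * (x * z) * y := by simp only [mul_assoc, mul_mul_self_cancel hy]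
  have hxz2 : (x * z) * (x * z) = 1 := by
    rw [hxz.symm.mul_mul_mul_comm, hx, hz, one_mul]
  have hw4 : (x * y * z) ^ 2 * (x * y * z) ^ 2 = 1 := by
    rw [hw2]
    have : y * (x * z) * y * (y * (x * z) * y) = y * ((x * z) * (x * z)) * y := by
      simp only [mul_assoc, mul_mul_self_cancel hy]
    rw [this, hxz2, mul_one, hy]
  have hw : (x * y * z) ^ 2 = 1 := by
    have hu : z * y * z * (z * y * z) = 1 := by
      simp only [mul_assoc, mul_mul_self_cancel hz, mul_mul_self_cancel hy, hz]
    have hp : x * z * (z * y * z) = x * y * z := by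
      simp only [mul_assoc, mul_mul_self_cancel hz]
    rcases involutions_mul_pow h hxz2 hu with h2 | h3
    · rwa [hp] at h2
    · rw [hp] at h3
      have : x * y * z = 1 := by
        rw [← pow_add, pow_succ, h3, one_mul] at hw4
        exact hw4
      rw [this, one_pow]
  rw [hw2] at hw
  have h1 : x * z = 1 := by
    have : y * (y * (x * z) * y) * y = y * 1 * y := by rw [hw]
    simpa only [mul_assoc, mul_mul_self_cancel hy, hy, mul_one, one_mul] using this
  rw [eq_inv_of_mul_eq_one_right h1, inv_eq_of_mul_eq_one_left hx]

/-- Every involution lies in the subgroup generated by two noncommuting involutions `x` and `y`.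
Otherwise it commutes with none of `x`, `y`, `x y x`, so `a = x y` and `b = x z` generate a group of
exponent three, and their commutator is trivial because `x` and `y` centralize it. -/
theorem involution_eq [Fintype G] (h : AllCayleyIntegral 3 G) {x y z : G}
    (hx : x * x = 1) (hy : y * y = 1) (hz : z * z = 1) (hxy : ¬ Commute x y) :
    z = 1 ∨ z = x ∨ z = y ∨ z = x * y * x := by
  by_contra! hc
  obtain ⟨hz1, hzx, hzy, hzw⟩ := hc
  have h3 : ∀ {u v : G}, u * u = 1 → v * v = 1 → ¬ Commute u v → (u * v) ^ 3 = 1 :=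
    fun hu hv huv => (involutions_mul_pow h hu hv).resolve_left fun e => huv (commute_of_sq hu hv e)
  -- an involution other than `z` that fails to commute with some involution fails to commute with `z`
  have key : ∀ {u v : G}, u * u = 1 → v * v = 1 → ¬ Commute u v → z ≠ u → ¬ Commute u z := by
    intro u v hu hv huv hzu huz
    by_cases hvz : Commute v z
    · have hr := h3 hu hv huv
      have hvz2 : (v * z) * (v * z) = 1 := by
        rw [hvz.symm.mul_mul_mul_comm, hv, hz, one_mul]
      have hrz : Commute (u * v) z := huz.mul_left hvz
      rcases involutions_mul_pow h hu hvz2 with e | e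
      · rw [← mul_assoc, hrz.mul_pow, pow_two z, hz, mul_one] at e
        exact huv (commute_of_sq hu hv e)
      · rw [← mul_assoc, hrz.mul_pow, hr, one_mul, pow_succ, pow_two, hz, one_mul] at e
        exact hz1 e
    · exact hzu (eq_of_commute_left h hu hv hz (h3 hu hv huv) huz (h3 hv hz hvz))
  have hr := h3 hx hy hxy
  have hne : x ≠ y := by rintro rfl; exact hxy (Commute.refl _)
  have hxz := key hx hy hxy hzx
  have hyz := key hy hx (fun e => hxy e.symm) hzy
  have hw : x * y * x * (x * y * x) = 1 := by
    simp only [mul_assoc, mul_mul_self_cancel hx, mul_mul_self_cancel hy, hx]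
  have hwx := not_commute_conj hx hxy
  have hwz := key hw hx hwx hzw
  -- the products `a = x y` and `b = x z` generate a group of exponent three inverted by `x`
  obtain ⟨a, ha⟩ : ∃ a, a = x * y := ⟨_, rfl⟩
  obtain ⟨b, hb⟩ : ∃ b, b = x * z := ⟨_, rfl⟩
  have hxa : x * a = y := by rw [ha, mul_mul_self_cancel hx]
  have hxb : x * b = z := by rw [hb, mul_mul_self_cancel hx]
  have hxi := inv_eq_of_mul_eq_one_left hx
  have hyi := inv_eq_of_mul_eq_one_left hy
  have hzi := inv_eq_of_mul_eq_one_left hz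
  have hai : x * a * x = a⁻¹ := by rw [hxa, ha, mul_inv_rev, hxi, hyi]
  have hbi : x * b * x = b⁻¹ := by rw [hxb, hb, mul_inv_rev, hxi, hzi]
  have ha3 : a ^ 3 = 1 := by rw [ha]; exact hr
  have hb3 : b ^ 3 = 1 := by rw [hb]; exact h3 hx hz hxz
  have hab3 : (a * b) ^ 3 = 1 := by
    rw [ha, hb, ← mul_assoc]
    exact h3 hw hz hwz
  have hab3' : (a * b⁻¹) ^ 3 = 1 := by
    have : a * b⁻¹ = x * (y * z) * x⁻¹ := by
      rw [ha, hb, mul_inv_rev, hzi]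
      simp only [mul_assoc]
    rw [this, conj_pow, h3 hy hz hyz, mul_one, mul_inv_cancel]
  obtain ⟨hc1, hc2⟩ := commute_conj_of_cube hb3 hab3 hab3'
  have haa : a * a = a⁻¹ := eq_inv_of_mul_eq_one_left (by rw [← ha3, pow_succ, pow_two])
  have hbb : b * b = b⁻¹ := eq_inv_of_mul_eq_one_left (by rw [← hb3, pow_succ, pow_two])
  obtain ⟨d, hd⟩ : ∃ d, d = b * a * b⁻¹ := ⟨_, rfl⟩
  rw [← hd] at hc1 hc2
  have hd3 : d ^ 3 = 1 := by rw [hd, conj_pow, ha3, mul_one, mul_inv_cancel]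
  have hdd : d * d = d⁻¹ := eq_inv_of_mul_eq_one_left (by rw [← hd3, pow_succ, pow_two])
  -- the commutator `a * d⁻¹` of `a` and `b` is centralized by `x` and `y`
  have hcx : Commute x (a * d⁻¹) := by
    have hxd : x * d * x = (a * d) := by
      rw [← hc2, hd]
      calc x * (b * a * b⁻¹) * x = (x * b * x) * (x * a * x) * (x * b * x)⁻¹ := by
            simp only [mul_inv_rev, hxi, mul_assoc, mul_mul_self_cancel hx]
        _ = _ := by rw [hai, hbi]; simp only [mul_inv_rev, inv_inv, mul_assoc]
    have : x * (a * d⁻¹) * x = a * d⁻¹ := by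
      calc x * (a * d⁻¹) * x = (x * a * x) * (x * d * x)⁻¹ := by
            simp only [mul_inv_rev, hxi, mul_assoc, mul_mul_self_cancel hx]
        _ = a⁻¹ * (d⁻¹ * a⁻¹) := by rw [hai, hxd, mul_inv_rev]
        _ = (a * a)⁻¹ * d⁻¹ := by rw [hc1.inv_inv.symm.eq, mul_inv_rev, mul_assoc]
        _ = a * d⁻¹ := by rw [haa, inv_inv]
    show _ * _ = _ * _
    nth_rewrite 1 [← this]
    simp only [mul_assoc, mul_mul_self_cancel hx]
  have hca : Commute a (a * d⁻¹) := (Commute.refl a).mul_right hc1.inv_right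
  have hcy : Commute y (a * d⁻¹) := by
    rw [← hxa]
    exact hcx.mul_left hca
  have hc3 : (a * d⁻¹) ^ 3 = 1 := by
    rw [hc1.inv_right.mul_pow, ha3, inv_pow, hd3, inv_one, mul_one]
  have hc := eq_one_of_commute_involutions h hx hy hr hne hc3 hcx hcy
  have hab : a * b = b * a := by
    have : a = d := by rw [mul_inv_eq_one] at hc; exact hc
    rw [this]
    nth_rewrite 1 [hd]
    rw [inv_mul_cancel_right, this]
  -- with `a` and `b` commuting, `Cay(G, {x, y, z})` is not integral
  have hx1 : x ≠ 1 := by rintro rfl; exact hxy (Commute.one_left y)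
  have hy1 : y ≠ 1 := by rintro rfl; exact hxy (Commute.one_right x)
  have hint := hasIntegralSpectrum_triple h hx hx1 hy hy1 hz hz1 hne hzx.symm hzy.symm
  rw [← hxa, ← hxb] at hint
  simp only [map_mul] at hint
  have hinv : ∀ u : G, u * u = u⁻¹ → x * u * x = u⁻¹ → x * u = u * u * x := by
    intro u hu hxu
    rw [hu, ← hxu, mul_assoc, hx, mul_one]
  have := hint.eq_zero_of_sq_apply (sq_apply_of_inverts (x := of ℝ G x) (a := of ℝ G a)
    (b := of ℝ G b) (by rw [← map_mul, hx, map_one])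
    (by rw [← map_mul, ← map_mul, haa, inv_mul_cancel, map_one])
    (by rw [← map_mul, ← map_mul, hbb, inv_mul_cancel, map_one])
    (by rw [← map_mul, hab, map_mul])
    (by simp only [← map_mul]; rw [hinv a haa hai])
    (by simp only [← map_mul]; rw [hinv b hbb hbi]))
  refine ne_zero_of_coeff_one ?_ this
  have hb1 : b ≠ 1 := by
    rw [hb]
    intro e
    exact hzx (by rw [eq_inv_of_mul_eq_one_right e, hxi])
  have hab1 : a * b ≠ 1 := by
    intro e
    apply hzw
    rw [← hxb, eq_inv_of_mul_eq_one_right e, ha, mul_inv_rev, hxi, hyi, mul_assoc]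
  have haab1 : a * a * b ≠ 1 := by
    intro e
    apply hzy
    rw [← hxb, ← hxa, eq_inv_of_mul_eq_one_right e, haa, inv_inv]
  simp only [add_mul, mul_sub, one_mul, mul_one, ← map_mul]
  classical
  simp only [of_apply, one_def, coeff_sub, coeff_add, coeff_single, Finsupp.sub_apply,
    Finsupp.add_apply, Finsupp.single_apply, hb1, hab1, haab1, if_true, if_false]
  split_ifs <;> norm_num

end SymmetricThree

/-! ### Recognition of the symmetric group of degree three -/

section SymmetricThreeRecognition

variable {G : Type*} [Group G]

theorem orderOf_eq_two_of_mul_self {x : G} (hx : x * x = 1) (hx1 : x ≠ 1) : orderOf x = 2 :=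
  orderOf_eq_prime (by rw [pow_two, hx]) hx1

/-- Because `x g` has order twice that of `g`. -/
theorem orderOf_of_odd_of_commute [Fintype G] (h : AllCayleyIntegral 3 G) {x g : G}
    (hx : x * x = 1) (hx1 : x ≠ 1) (hxg : Commute x g) (hg : ¬ Even (orderOf g)) :
    orderOf g = 1 ∨ orderOf g = 3 := by
  have hx2 := orderOf_eq_two_of_mul_self hx hx1
  have hodd := Nat.not_even_iff_odd.1 hg
  have := hxg.orderOf_mul_eq_mul_orderOf_of_coprime (by rw [hx2]; exact hodd.coprime_two_left)
  rw [hx2] at this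
  have := orderOf_of_even h (y := x * g) (by rw [this]; exact even_two_mul _)
  obtain ⟨m, hm⟩ := hodd
  omega

theorem eq_one_of_commute_pair [Fintype G] (h : AllCayleyIntegral 3 G) {x y g : G}
    (hx : x * x = 1) (hy : y * y = 1) (hxy : ¬ Commute x y)
    (hxg : Commute x g) (hyg : Commute y g) : g = 1 := by
  have hx1 : x ≠ 1 := by rintro rfl; exact hxy (Commute.one_left y)
  by_cases he : Even (orderOf g)
  · exfalso
    obtain ⟨m, hm⟩ := he
    have h0 := orderOf_pos g
    have ht1 : g ^ m ≠ 1 := pow_ne_one_of_lt_orderOf (by omega) (by omega)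
    have ht : g ^ m * g ^ m = 1 := by rw [← pow_add, ← hm, pow_orderOf_eq_one]
    have hxt := hxg.pow_right m
    have hyt := hyg.pow_right m
    rcases involution_eq h hx hy ht hxy with e | e | e | e
    · exact ht1 e
    · rw [e] at hyt
      exact hxy hyt.symm
    · rw [e] at hxt
      exact hxy hxt
    · rw [e] at hxt
      exact not_commute_conj hx hxy hxt.symm
  · rcases orderOf_of_odd_of_commute h hx hx1 hxg he with e | e
    · exact orderOf_eq_one_iff.1 e
    · refine eq_one_of_commute_involutions h hx hy ?_ (fun e => hxy (e ▸ Commute.refl x))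
        (e ▸ pow_orderOf_eq_one g) hxg hyg
      exact (involutions_mul_pow h hx hy).resolve_left fun e => hxy (commute_of_sq hx hy e)

/-- The conjugation action of a group on its involutions. -/
def conjInvolutions (G : Type*) [Group G] :
    G →* Equiv.Perm {t : G // t * t = 1 ∧ t ≠ 1} where
  toFun g := Equiv.Perm.subtypePerm (MulAut.conj g).toEquiv (fun t => by
    simp [conj_mul])
  map_one' := by
    ext t
    simp
  map_mul' g k := by
    ext t
    show g * k * t * (g * k)⁻¹ = g * (k * t * k⁻¹) * g⁻¹
    group

/-- The conjugation action on the three involutions is faithful by `eq_one_of_commute_pair`. -/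
theorem nonempty_mulEquiv_perm_three [Fintype G] (h : AllCayleyIntegral 3 G) {x y : G}
    (hx : x * x = 1) (hy : y * y = 1) (hxy : ¬ Commute x y) :
    Nonempty (G ≃* Equiv.Perm (Fin 3)) := by
  classical
  have hx1 : x ≠ 1 := by rintro rfl; exact hxy (Commute.one_left y)
  have hy1 : y ≠ 1 := by rintro rfl; exact hxy (Commute.one_right x)
  have hne : x ≠ y := by rintro rfl; exact hxy (Commute.refl _)
  have hcube := (involutions_mul_pow h hx hy).resolve_left fun e => hxy (commute_of_sq hx hy e)
  have hr1 : x * y ≠ 1 := fun e => hne ((eq_inv_of_mul_eq_one_left e).trans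
    (inv_eq_of_mul_eq_one_left hy))
  have hw : x * y * x * (x * y * x) = 1 := by
    simp only [mul_assoc, mul_mul_self_cancel hx, mul_mul_self_cancel hy, hx]
  have hwx := not_commute_conj hx hxy
  have hcard : Fintype.card {t : G // t * t = 1 ∧ t ≠ 1} = 3 := by
    rw [Fintype.card_subtype]
    have : (Finset.univ.filter fun t : G => t * t = 1 ∧ t ≠ 1) = {x, y, x * y * x} := by
      ext t
      simp only [Finset.mem_filter, Finset.mem_univ, true_and, Finset.mem_insert,
        Finset.mem_singleton]
      constructor
      · rintro ⟨ht, ht1⟩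
        exact (involution_eq h hx hy ht hxy).resolve_left ht1
      · rintro (rfl | rfl | rfl)
        · exact ⟨hx, hx1⟩
        · exact ⟨hy, hy1⟩
        · exact ⟨hw, fun e => hwx (e ▸ Commute.one_left x)⟩
    rw [this]
    refine Finset.card_eq_three.2 ⟨x, y, x * y * x, hne, ?_, ?_, rfl⟩
    · intro e
      exact hwx (e ▸ Commute.refl x)
    · intro e
      apply hxy
      show x * y = y * x
      nth_rewrite 2 [e]
      rw [mul_assoc, hx, mul_one]
  have hinj : Function.Injective (conjInvolutions G) := by
    rw [injective_iff_map_eq_one]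
    intro g hg
    have hfix : ∀ t : G, t * t = 1 → t ≠ 1 → Commute t g := by
      intro t ht ht1
      have := congrArg Subtype.val (Equiv.congr_fun hg ⟨t, ht, ht1⟩)
      have e : g * t * g⁻¹ = t := by simpa [conjInvolutions] using this
      exact (mul_inv_eq_iff_eq_mul.1 e).symm
    exact eq_one_of_commute_pair h hx hy hxy (hfix x hx hx1) (hfix y hy hy1)
  have hP : Fintype.card (Equiv.Perm {t : G // t * t = 1 ∧ t ≠ 1}) = 6 := by
    rw [Fintype.card_perm, hcard]
    rfl
  have hG : Fintype.card G = 6 := by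
    have hle := Fintype.card_le_of_injective _ hinj
    have h2 : 2 ∣ Fintype.card G := orderOf_eq_two_of_mul_self hx hx1 ▸ orderOf_dvd_card
    have h3 : 3 ∣ Fintype.card G := by
      rw [← orderOf_eq_prime (p := 3) hcube hr1]
      exact orderOf_dvd_card
    have hpos : 0 < Fintype.card G := Fintype.card_pos
    omega
  have hbij : Function.Bijective (conjInvolutions G) :=
    (Fintype.bijective_iff_injective_and_card _).2 ⟨hinj, by rw [hG, hP]⟩
  exact ⟨(MulEquiv.ofBijective _ hbij).trans
    (Equiv.permCongrHom (Fintype.equivFinOfCardEq hcard))⟩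

end SymmetricThreeRecognition

/-! ### Groups in which all involutions commute -/

section CommutingInvolutions

variable {G : Type*} [Group G]

open Classical in
/-- If all involutions commute, the elements squaring to `1` form an elementary abelian normal
subgroup, whose sum in the group algebra is fixed by every involution. On the product of
the cosine eigenvector of `y` with this central sum, `x` acts trivially. -/
theorem orderOf_of_odd [Fintype G] (h : AllCayleyIntegral 3 G)
    (hcomm : ∀ s t : G, s * s = 1 → t * t = 1 → Commute s t) {x y : G}
    (hx : x * x = 1) (hx1 : x ≠ 1) (hy : ¬ Even (orderOf y)) :
    orderOf y = 1 ∨ orderOf y = 3 := by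
  by_cases hyy : y * y = 1
  · left
    have h1 : orderOf y ∣ 2 := orderOf_dvd_of_pow_eq_one (by rw [pow_two, hyy])
    rcases (Nat.dvd_prime Nat.prime_two).1 h1 with h | h
    · exact h
    · rw [h] at hy
      exact absurd even_two hy
  set E : Finset G := Finset.univ.filter fun e => e * e = 1 with hE
  have hmem : ∀ e, e ∈ E ↔ e * e = 1 := by simp [hE]
  set σ : MonoidAlgebra ℝ G := ∑ e ∈ E, of ℝ G e with hσ
  have hxσ : of ℝ G x * σ = σ := by
    rw [hσ, Finset.mul_sum]
    refine Finset.sum_bij (fun e _ => x * e) ?_ ?_ ?_ ?_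
    · intro e he
      rw [hmem] at he ⊢
      rw [(hcomm x e hx he).symm.mul_mul_mul_comm, hx, he, one_mul]
    · intro a _ b _ e
      exact mul_left_cancel e
    · intro e he
      rw [hmem] at he
      refine ⟨x * e, ?_, mul_mul_self_cancel hx e⟩
      rw [hmem, (hcomm x e hx he).symm.mul_mul_mul_comm, hx, he, one_mul]
    · intro e _
      rw [map_mul]
  have hgσ : ∀ g : G, Commute (of ℝ G g) σ := by
    intro g
    show _ * _ = _ * _
    rw [hσ, Finset.mul_sum, Finset.sum_mul]
    refine Finset.sum_bij (fun e _ => g * e * g⁻¹) ?_ ?_ ?_ ?_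
    · intro e he
      rw [hmem] at he ⊢
      rw [conj_mul, he, mul_one, mul_inv_cancel]
    · intro a _ b _ e
      simpa using e
    · intro e he
      rw [hmem] at he
      refine ⟨g⁻¹ * e * g, ?_, by simp [mul_assoc]⟩
      rw [hmem]
      have : g⁻¹ * e * g * (g⁻¹ * e * g) = g⁻¹ * (e * e) * g := by simp [mul_assoc]
      rw [this, he, mul_one, inv_mul_cancel]
    · intro e _
      rw [← map_mul, ← map_mul, inv_mul_cancel_right]
  have hcσ : Commute (cosElt y) σ :=
    Commute.sum_left _ _ _ fun k _ => Commute.smul_left (hgσ _) _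
  have := orderOf_eq_of_eigenvector (ε := 1) h hx hx1 hyy (v := cosElt y * σ) ?_ ?_ ?_
  · rcases this with e | e | e
    · exact Or.inr e
    · rw [e] at hy
      exact absurd (by decide) hy
    · rw [e] at hy
      exact absurd (by decide) hy
  · apply ne_zero_of_coeff_one
    have hsum : (cosElt y * σ).coeff 1 = ∑ e ∈ E, (cosElt y).coeff e⁻¹ := by
      rw [hσ, Finset.mul_sum, coeff_sum, Finset.sum_apply']
      refine Finset.sum_congr rfl fun e _ => ?_
      rw [of_apply, coeff_mul_single_apply, mul_one, one_mul]
    rw [hsum, Finset.sum_eq_single 1, inv_one, coeff_cosElt_one]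
    · norm_num
    · intro e he he1
      rw [hmem] at he
      apply coeff_cosElt_of_notMem
      intro hmemz
      rw [inv_eq_of_mul_eq_one_left he] at hmemz
      have := orderOf_dvd_of_mem_zpowers hmemz
      rw [orderOf_eq_two_of_mul_self he he1] at this
      exact hy (even_iff_two_dvd.2 this)
    · intro h1
      exact absurd ((hmem 1).2 (one_mul 1)) h1
  · rw [← mul_assoc, mul_cosElt, smul_mul_assoc]
  · rw [hcσ.eq, ← mul_assoc, hxσ]
    simp

/-- The action of `x + z + z⁻¹` on `u` for a sign character of the conjugates of `x` under `z` that
is `-1` on exactly one of them. -/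
theorem sq_apply_of_cube {A : Type*} [Ring A] [Algebra ℝ A] {x z u : A} (hz : z * z * z = 1)
    (hxu : x * u = -u) (h1 : x * (z * u) = z * u) (h2 : x * (z * (z * u)) = z * (z * u)) :
    (x + z + z * z) * ((x + z + z * z) * u) = (1 : ℝ) • ((x + z + z * z) * u) + (4 : ℝ) • u := by
  have h3 : z * (z * (z * u)) = u := by rw [← mul_assoc, ← mul_assoc, hz, one_mul]
  have hM : (x + z + z * z) * u = -u + z * u + z * (z * u) := by
    rw [add_mul, add_mul, hxu, mul_assoc]
  rw [hM]
  simp only [add_mul, mul_add, mul_neg, mul_assoc, hxu, h1, h2, h3]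
  module

/-- If all involutions commute, an involution `x` and a noncommuting `z` of order three satisfy
the relations of the alternating group of degree four: `(x z) ^ 3` is the product of the three
conjugates of `x` under `z`. -/
theorem mul_pow_three_eq_one [Fintype G] (h : AllCayleyIntegral 3 G)
    (hcomm : ∀ s t : G, s * s = 1 → t * t = 1 → Commute s t) {x z : G}
    (hx : x * x = 1) (hz : z ^ 3 = 1) (hxz : ¬ Commute x z) : (x * z) ^ 3 = 1 := by
  by_contra hne
  have hx1 : x ≠ 1 := by rintro rfl; exact hxz (Commute.one_left z)
  have hzz : z * z = z⁻¹ := eq_inv_of_mul_eq_one_left (by rw [← hz, pow_succ, pow_two])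
  have hzz' : z⁻¹ * z⁻¹ = z := by rw [← mul_inv_rev, hzz, inv_inv]
  have hz2 : z * z ≠ 1 := by
    intro e
    rw [pow_succ, pow_two, e, one_mul] at hz
    exact hxz (hz ▸ Commute.one_right x)
  obtain ⟨a, ha⟩ : ∃ a, a = z * x * z⁻¹ := ⟨_, rfl⟩
  obtain ⟨b, hb⟩ : ∃ b, b = z⁻¹ * x * z := ⟨_, rfl⟩
  have haa : a * a = 1 := by rw [ha, conj_mul, hx, mul_one, mul_inv_cancel]
  have hbb : b * b = 1 := by
    rw [hb]
    simp [mul_assoc, mul_mul_self_cancel hx]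
  have hxa : x * a ≠ 1 := by
    intro e
    apply hxz
    have : x = z * x * z⁻¹ := by
      rw [← ha, eq_inv_of_mul_eq_one_left e, inv_eq_of_mul_eq_one_left haa]
    rw [eq_mul_inv_iff_mul_eq] at this
    exact this
  have hxb : x * b ≠ 1 := by
    intro e
    apply hxz
    have : z⁻¹ * x * z = x := by
      rw [← hb, eq_inv_of_mul_eq_one_right e, inv_eq_of_mul_eq_one_left hx]
    rw [mul_assoc, inv_mul_eq_iff_eq_mul] at this
    exact this
  have hxab : x * a * b ≠ 1 := by
    intro e
    apply hne
    rw [← e, ha, hb]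
    calc (x * z) ^ 3 = x * z * x * z * x * z := by
          simp only [pow_succ, pow_zero, one_mul, mul_assoc]
      _ = x * z * x * (z⁻¹ * z⁻¹) * x * z := by rw [hzz']
      _ = _ := by simp only [mul_assoc]
  have hX : of ℝ G x * of ℝ G x = 1 := by rw [← map_mul, hx, map_one]
  have hA : of ℝ G a * of ℝ G a = 1 := by rw [← map_mul, haa, map_one]
  have hB : of ℝ G b * of ℝ G b = 1 := by rw [← map_mul, hbb, map_one]
  have hAB : of ℝ G b * of ℝ G a = of ℝ G a * of ℝ G b := by
    rw [← map_mul, (hcomm b a hbb haa).eq, map_mul]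
  have hXA : of ℝ G a * of ℝ G x = of ℝ G x * of ℝ G a := by
    rw [← map_mul, (hcomm a x haa hx).eq, map_mul]
  have hXB : of ℝ G b * of ℝ G x = of ℝ G x * of ℝ G b := by
    rw [← map_mul, (hcomm b x hbb hx).eq, map_mul]
  -- a vector on which `x` acts as `-1` and both of its conjugates as `1`
  obtain ⟨u, hu⟩ : ∃ u, u = (1 - of ℝ G x) * (1 + of ℝ G a) * (1 + of ℝ G b) := ⟨_, rfl⟩
  have hxu : of ℝ G x * u = -u := by
    rw [hu, ← mul_assoc, ← mul_assoc, mul_sub, hX]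
    noncomm_ring
  have hau : of ℝ G a * u = u := by
    have : of ℝ G a * (1 - of ℝ G x) = (1 - of ℝ G x) * of ℝ G a := by
      rw [mul_sub, hXA, mul_one, sub_mul, one_mul]
    rw [hu, ← mul_assoc, ← mul_assoc, this, mul_assoc (1 - of ℝ G x), mul_add (of ℝ G a), hA, mul_one,
      add_comm (of ℝ G a)]
  have hbu : of ℝ G b * u = u := by
    have h1 : of ℝ G b * (1 - of ℝ G x) = (1 - of ℝ G x) * of ℝ G b := by
      rw [mul_sub, hXB, mul_one, sub_mul, one_mul]
    have h2 : of ℝ G b * (1 + of ℝ G a) = (1 + of ℝ G a) * of ℝ G b := by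
      rw [mul_add, hAB, mul_one, add_mul, one_mul]
    rw [hu, ← mul_assoc, ← mul_assoc, h1, mul_assoc (1 - of ℝ G x), h2, ← mul_assoc,
      mul_assoc _ (of ℝ G b), mul_add (of ℝ G b), hB, mul_one, add_comm (of ℝ G b)]
  have hu0 : u ≠ 0 := by
    apply ne_zero_of_coeff_one
    rw [hu]
    simp only [sub_mul, add_mul, mul_add, one_mul, mul_one, ← map_mul]
    classical
    simp only [of_apply, one_def, coeff_sub, coeff_add, coeff_single, Finsupp.sub_apply,
      Finsupp.add_apply, Finsupp.single_apply, hxa, hxb, hxab, hx1, if_true, if_false]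
    split_ifs <;> norm_num
  have hint := hasIntegralSpectrum_pair h hx hx1 hz2
  rw [← hzz, map_mul] at hint
  have hZ : of ℝ G z * of ℝ G z * of ℝ G z = 1 := by
    rw [← map_mul, ← map_mul, hzz, inv_mul_cancel, map_one]
  have hxz1 : of ℝ G x * (of ℝ G z * u) = of ℝ G z * u := by
    rw [← mul_assoc, ← map_mul]
    have : x * z = z * b := by rw [hb]; simp [mul_assoc]
    rw [this, map_mul, mul_assoc, hbu]
  have hxz2 : of ℝ G x * (of ℝ G z * (of ℝ G z * u)) = of ℝ G z * (of ℝ G z * u) := by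
    rw [← mul_assoc (of ℝ G z), ← map_mul, ← mul_assoc, ← map_mul]
    have : x * (z * z) = (z * z) * a := by rw [ha, hzz]; simp [mul_assoc]
    rw [this, map_mul, mul_assoc, hau]
  obtain ⟨k, hk⟩ := hint.exists_root (p := 1) (q := 4) hu0 (by norm_num)
    (sq_apply_of_cube hZ hxu hxz1 hxz2)
  have hk' : k ^ 2 = k + 4 := by
    have : (k : ℝ) ^ 2 = k + 4 := by linarith
    exact_mod_cast this
  have : k ≤ 3 := by nlinarith
  have : -2 ≤ k := by nlinarith
  interval_cases k <;> omega

/-- Here `a` is the conjugate of `x` by `y` and `y ^ 4 = 1`: where `y ^ 2 = 1` and `x a = -1`, the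
element `x + y + y⁻¹` acts as `x + 2 y` with `x` and `y` anticommuting. -/
theorem sq_apply_of_fourth {A : Type*} [Ring A] {x a y : A} (hx : x * x = 1) (ha : a * a = 1)
    (hxa : a * x = x * a) (hy : y * y * (y * y) = 1) (hyx : y * x = a * y) (hya : y * a = x * y) :
    (x + y + y * y * y) * ((x + y + y * y * y) * ((1 - x * a) * (1 + y * y))) =
      5 * ((1 - x * a) * (1 + y * y)) := by
  obtain ⟨p, hp⟩ : ∃ p, p = 1 - x * a := ⟨_, rfl⟩
  obtain ⟨f, hf⟩ : ∃ f, f = p * (1 + y * y) := ⟨_, rfl⟩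
  have hyp : y * p = p * y := by
    have : y * (x * a) = x * a * y := by
      rw [← mul_assoc, hyx, mul_assoc, hya, ← mul_assoc, hxa]
    rw [hp, mul_sub, this, mul_one, sub_mul, one_mul]
  have hyyf : y * (y * f) = f := by
    have : y * y * (1 + y * y) = 1 + y * y := by rw [mul_add, mul_one, hy, add_comm]
    rw [hf, ← mul_assoc y p, hyp, mul_assoc p, ← mul_assoc y p, hyp, mul_assoc p, ← mul_assoc y y,
      this]
  have hyyx : ∀ w, y * (y * (x * w)) = x * (y * (y * w)) := by
    intro w
    rw [← mul_assoc y x, hyx, mul_assoc a, ← mul_assoc y a, hya, mul_assoc x]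
  have hyxf : y * (x * f) = a * (y * f) := by rw [← mul_assoc, hyx, mul_assoc]
  have hzero : a * (y * f) + x * (y * f) = 0 := by
    have : (a + x) * p = 0 := by
      have : (a + x) * (1 - x * a) = a + x - a * x * a - x * x * a := by noncomm_ring
      rw [hp, this, hxa, mul_assoc x a a, ha, hx]
      noncomm_ring
    rw [← add_mul, hf, ← mul_assoc y p, hyp, mul_assoc p, ← mul_assoc, this, zero_mul]
  rw [← hp, ← hf]
  have h1 : (x + y + y * y * y) * f = x * f + (y * f + y * f) := by
    rw [add_mul, add_mul, mul_assoc (y * y), mul_assoc y y, hyyf, add_assoc]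
  have h2 : (x + y + y * y * y) * (x * f) = f + (a * (y * f) + a * (y * f)) := by
    rw [add_mul, add_mul, mul_assoc (y * y), mul_assoc y y, hyyx, hyyf, hyxf, ← mul_assoc x x, hx,
      one_mul, add_assoc]
  have h3 : (x + y + y * y * y) * (y * f) = x * (y * f) + (f + f) := by
    rw [add_mul, add_mul, mul_assoc (y * y), mul_assoc y y, hyyf, hyyf, add_assoc]
  have h4 : a * (y * f) = -(x * (y * f)) := eq_neg_of_add_eq_zero_left hzero
  rw [h1, mul_add, mul_add, h2, h3, h4]
  noncomm_ring

/-- An element whose fourth power is `1` commutes with every involution. -/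
theorem commute_of_pow_four [Fintype G] (h : AllCayleyIntegral 3 G)
    (hcomm : ∀ s t : G, s * s = 1 → t * t = 1 → Commute s t) {x y : G}
    (hx : x * x = 1) (hy : y ^ 4 = 1) : Commute x y := by
  by_contra hxy
  have hx1 : x ≠ 1 := by rintro rfl; exact hxy (Commute.one_left y)
  have hyy : y * y * (y * y) = 1 := by rw [← hy]; simp only [pow_succ, pow_zero, one_mul, mul_assoc]
  have hyy1 : y * y ≠ 1 := fun e => hxy (hcomm x y hx e)
  have hyi : y⁻¹ = y * y * y := inv_eq_of_mul_eq_one_left (by rw [← hyy]; simp only [mul_assoc])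
  have hxyy := hcomm x (y * y) hx hyy
  obtain ⟨a, ha⟩ : ∃ a, a = y * x * y⁻¹ := ⟨_, rfl⟩
  have haa : a * a = 1 := by rw [ha, conj_mul, hx, mul_one, mul_inv_cancel]
  have hyx : y * x = a * y := by rw [ha, inv_mul_cancel_right]
  have hya : y * a = x * y := by
    rw [ha, ← mul_assoc, ← mul_assoc, ← hxyy.eq]
    simp [mul_assoc]
  have hxa : x * a ≠ 1 := by
    intro e
    apply hxy
    have : a = x := by rw [eq_inv_of_mul_eq_one_right e, inv_eq_of_mul_eq_one_left hx]
    rw [this] at hya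
    exact hya.symm
  -- otherwise `x y` would be an involution not commuting with `x`
  have hxay : x * a * (y * y) ≠ 1 := by
    intro e
    have hxy2 : x * y * (x * y) = 1 := by
      rw [← e, mul_assoc x y, ← mul_assoc y x, hyx]
      simp only [mul_assoc]
    have := hcomm x (x * y) hx hxy2
    apply hxy
    have e' : x * (x * y) = x * y * x := this
    show x * y = y * x
    rw [mul_assoc] at e'
    exact mul_left_cancel e'
  have hf0 : (1 - of ℝ G x * of ℝ G a) * (1 + of ℝ G y * of ℝ G y) ≠ 0 := by
    apply ne_zero_of_coeff_one
    simp only [sub_mul, mul_add, one_mul, mul_one, ← map_mul]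
    classical
    simp only [of_apply, one_def, coeff_sub, coeff_add, coeff_single, Finsupp.sub_apply,
      Finsupp.add_apply, Finsupp.single_apply, hxa, hxay, if_true, if_false]
    split_ifs <;> norm_num
  have hint := hasIntegralSpectrum_pair h hx hx1 hyy1
  rw [hyi] at hint
  simp only [map_mul] at hint
  obtain ⟨k, hk⟩ := hint.exists_root (p := 0) (q := 5)
    hf0 (by norm_num) (by
      rw [sq_apply_of_fourth, zero_smul, zero_add, ← Nat.cast_ofNat (R := MonoidAlgebra ℝ G),
        ← nsmul_eq_mul]
      · module
      · rw [← map_mul, hx, map_one]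
      · rw [← map_mul, haa, map_one]
      · rw [← map_mul, (hcomm a x haa hx).eq, map_mul]
      · simp only [← map_mul]; rw [hyy, map_one]
      · rw [← map_mul, hyx, map_mul]
      · rw [← map_mul, hya, map_mul])
  have hk' : k ^ 2 = 5 := by
    have : (k : ℝ) ^ 2 = 5 := by linarith
    exact_mod_cast this
  have : k ≤ 3 := by nlinarith
  have : -3 ≤ k := by nlinarith
  interval_cases k <;> omega

/-- An element of order six commutes with every involution. Otherwise `mul_pow_three_eq_one` applies
to both `x` and `x * y ^ 3`, which contradicts `y ^ 3 ≠ 1`. -/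
theorem commute_of_pow_six [Fintype G] (h : AllCayleyIntegral 3 G)
    (hcomm : ∀ s t : G, s * s = 1 → t * t = 1 → Commute s t) {x y : G}
    (hx : x * x = 1) (hy : orderOf y = 6) : Commute x y := by
  have h6 : y ^ 6 = 1 := hy ▸ pow_orderOf_eq_one y
  have ht : y ^ 3 * y ^ 3 = 1 := by rw [← pow_add, h6]
  have ht1 : y ^ 3 ≠ 1 := pow_ne_one_of_lt_orderOf (by norm_num) (by omega)
  have hz : (y ^ 2) ^ 3 = 1 := by rw [← pow_mul, h6]
  have htz : Commute (y ^ 3) (y ^ 2) := (Commute.refl y).pow_pow 3 2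
  have hxt := hcomm x (y ^ 3) hx ht
  have hxz : Commute x (y ^ 2) := by
    by_contra hxz
    have h1 := mul_pow_three_eq_one h hcomm hx hz hxz
    have hxt2 : x * y ^ 3 * (x * y ^ 3) = 1 := by
      rw [hxt.symm.mul_mul_mul_comm, hx, ht, one_mul]
    have h2 := mul_pow_three_eq_one h hcomm hxt2 hz (by
      intro e
      apply hxz
      have := e.mul_left htz
      rwa [mul_assoc, ht, mul_one] at this)
    rw [mul_assoc, htz.eq, ← mul_assoc, (hxt.symm.mul_right htz).symm.mul_pow, h1, one_mul, pow_succ,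
      pow_two, ht, one_mul] at h2
    exact ht1 h2
  have : y = y ^ 3 * (y ^ 2)⁻¹ := by
    rw [eq_mul_inv_iff_mul_eq, ← pow_succ']
  rw [this]
  exact hxt.mul_right hxz.inv_right

end CommutingInvolutions

/-! ### The listed groups by relations -/

section PairRelations

variable {G : Type*} [Group G]

/-- The relations between an involution `x` and an element `y` that characterize the groups
`⟨x, y⟩` of the list: abelian with `y` of order dividing `4` or `6`, or a quotient of the
presentation `x² = y³ = (x y)³ = 1` of the alternating group of degree four. -/
def PairRelation (x y : G) : Prop :=
  (Commute x y ∧ (y ^ 4 = 1 ∨ y ^ 6 = 1)) ∨ (y ^ 3 = 1 ∧ (x * y) ^ 3 = 1)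

theorem PairRelation.of_map {H : Type*} [Group H] {f : G →* H} (hf : Function.Injective f)
    {x y : G} (h : PairRelation (f x) (f y)) : PairRelation x y := by
  rcases h with ⟨hc, h⟩ | ⟨h1, h2⟩
  · refine Or.inl ⟨hf (by rw [map_mul, map_mul, hc.eq]), ?_⟩
    rcases h with h | h
    · exact Or.inl (hf (by rw [map_pow, h, map_one]))
    · exact Or.inr (hf (by rw [map_pow, h, map_one]))
  · exact Or.inr ⟨hf (by rw [map_pow, h1, map_one]), hf (by rw [map_pow, map_mul, h2, map_one])⟩

theorem pairRelation_alternatingGroup (a b : alternatingGroup (Fin 4)) (h : a * a = 1) :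
    PairRelation a b := by
  have key : ∀ a b : alternatingGroup (Fin 4), a * a = 1 →
      (a * b = b * a ∧ b ^ 6 = 1) ∨ (b ^ 3 = 1 ∧ (a * b) ^ 3 = 1) := by decide +kernel
  rcases key a b h with ⟨h1, h2⟩ | h1
  · exact Or.inl ⟨h1, Or.inr h2⟩
  · exact Or.inr h1

theorem IsListed.pairRelation {H : Type*} [Group H] (hH : IsListed H) {x y : H}
    (hx : x * x = 1) : PairRelation x y := by
  rcases hH with ⟨⟨e⟩⟩ | ⟨⟨e⟩⟩ | ⟨⟨e⟩⟩ | ⟨⟨e⟩⟩ | ⟨⟨e⟩⟩ | ⟨⟨e⟩⟩ | ⟨⟨e⟩⟩ <;>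
    refine PairRelation.of_map (f := e.toMonoidHom) e.injective ?_
  · exact Or.inl ⟨mul_comm _ _, Or.inl ((by decide : ∀ a : Multiplicative (ZMod 2), a ^ 4 = 1) _)⟩
  · exact Or.inl ⟨mul_comm _ _,
      Or.inl ((by decide : ∀ a : Multiplicative (ZMod 2 × ZMod 2), a ^ 4 = 1) _)⟩
  · exact Or.inl ⟨mul_comm _ _, Or.inl ((by decide : ∀ a : Multiplicative (ZMod 4), a ^ 4 = 1) _)⟩
  · exact Or.inl ⟨mul_comm _ _, Or.inr ((by decide : ∀ a : Multiplicative (ZMod 6), a ^ 6 = 1) _)⟩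
  · exact Or.inl ⟨mul_comm _ _,
      Or.inl ((by decide : ∀ a : Multiplicative (ZMod 2 × ZMod 4), a ^ 4 = 1) _)⟩
  · exact Or.inl ⟨mul_comm _ _,
      Or.inr ((by decide : ∀ a : Multiplicative (ZMod 2 × ZMod 6), a ^ 6 = 1) _)⟩
  · exact pairRelation_alternatingGroup _ _ (by
      rw [← map_mul, hx, map_one])

theorem pairRelation_of_isListed_closure {x y : G}
    (h : IsListed (Subgroup.closure ({x, y} : Set G))) (hx : x * x = 1) : PairRelation x y := by
  have hxm : x ∈ Subgroup.closure ({x, y} : Set G) := Subgroup.subset_closure (by simp)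
  have hym : y ∈ Subgroup.closure ({x, y} : Set G) := Subgroup.subset_closure (by simp)
  rcases h.pairRelation (x := ⟨x, hxm⟩) (y := ⟨y, hym⟩) (Subtype.ext hx) with ⟨hc, h⟩ | ⟨h1, h2⟩
  · exact Or.inl ⟨congrArg Subtype.val hc, h.imp (congrArg Subtype.val) (congrArg Subtype.val)⟩
  · exact Or.inr ⟨congrArg Subtype.val h1, congrArg Subtype.val h2⟩

theorem nonempty_mulEquiv_zmod {H : Type*} [Group H] [IsCyclic H] {n : ℕ} (hn : Nat.card H = n) :
    Nonempty (H ≃* Multiplicative (ZMod n)) := by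
  subst hn
  exact ⟨(zmodCyclicMulEquiv inferInstance).symm⟩

theorem closure_pair_eq_sup (x y : G) :
    Subgroup.closure ({x, y} : Set G) = Subgroup.zpowers x ⊔ Subgroup.zpowers y := by
  rw [Set.insert_eq, Subgroup.closure_union, Subgroup.zpowers_eq_closure,
    Subgroup.zpowers_eq_closure]

theorem nonempty_mulEquiv_of_closure_eq_zpowers {x y g : G}
    (h : Subgroup.closure ({x, y} : Set G) = Subgroup.zpowers g) {n : ℕ} (hn : orderOf g = n) :
    Nonempty (Subgroup.closure ({x, y} : Set G) ≃* Multiplicative (ZMod n)) := by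
  rw [h]
  exact nonempty_mulEquiv_zmod (by rw [Nat.card_zpowers, hn])

theorem nonempty_mulEquiv_prod {x y : G} (hx : orderOf x = 2) (hxy : Commute x y)
    (hmem : x ∉ Subgroup.zpowers y) {n : ℕ} (hn : orderOf y = n) :
    Nonempty (Subgroup.closure ({x, y} : Set G) ≃* Multiplicative (ZMod 2 × ZMod n)) := by
  have hcomm : ∀ (m : Subgroup.zpowers x) (k : Subgroup.zpowers y),
      Commute ((Subgroup.zpowers x).subtype m) ((Subgroup.zpowers y).subtype k) := by
    rintro ⟨_, i, rfl⟩ ⟨_, j, rfl⟩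
    exact hxy.zpow_zpow i j
  have hinj : Function.Injective
      ((Subgroup.zpowers x).subtype.noncommCoprod (Subgroup.zpowers y).subtype hcomm) := by
    rw [MonoidHom.noncommCoprod_injective]
    refine ⟨Subtype.val_injective, Subtype.val_injective, ?_⟩
    rw [Subgroup.range_subtype, Subgroup.range_subtype, Subgroup.disjoint_def]
    rintro _ ⟨i, rfl⟩ hi
    have h2 : x ^ 2 = 1 := by rw [← hx, pow_orderOf_eq_one]
    rcases Int.even_or_odd' i with ⟨m, rfl | rfl⟩
    · simp [zpow_mul, h2]
    · refine absurd ?_ hmem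
      simpa [zpow_add, zpow_mul, h2] using hi
  have hrange : ((Subgroup.zpowers x).subtype.noncommCoprod (Subgroup.zpowers y).subtype
      hcomm).range = Subgroup.closure ({x, y} : Set G) := by
    rw [MonoidHom.noncommCoprod_range, Subgroup.range_subtype, Subgroup.range_subtype,
      closure_pair_eq_sup]
  obtain ⟨e1⟩ := nonempty_mulEquiv_zmod (H := Subgroup.zpowers x) (n := 2)
    (by rw [Nat.card_zpowers, hx])
  obtain ⟨e2⟩ := nonempty_mulEquiv_zmod (H := Subgroup.zpowers y) (n := n)
    (by rw [Nat.card_zpowers, hn])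
  rw [← hrange]
  exact ⟨((MonoidHom.ofInjective hinj).symm.trans (e1.prodCongr e2)).trans
    (MulEquiv.prodMultiplicative _ _).symm⟩

/-- A group generated by `x` and `y` subject to `x² = y³ = (x y)³ = 1` with `x ≠ 1` is the
alternating group of degree four. -/
theorem nonempty_mulEquiv_alternatingGroup [Finite G] {x y : G} (hx : x * x = 1) (hx1 : x ≠ 1)
    (hy : y ^ 3 = 1) (hxy : (x * y) ^ 3 = 1) (htop : Subgroup.closure ({x, y} : Set G) = ⊤) :
    Nonempty (G ≃* alternatingGroup (Fin 4)) := by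
  classical
  have := Fintype.ofFinite G
  have hnc : ¬ Commute x y := by
    intro hc
    rw [hc.mul_pow, hy, mul_one, pow_succ, pow_two, hx, one_mul] at hxy
    exact hx1 hxy
  have hy1 : y ≠ 1 := by rintro rfl; exact hnc (Commute.one_right x)
  have hyy : y * y = y⁻¹ := eq_inv_of_mul_eq_one_left (by rw [← hy, pow_succ, pow_two])
  have hyy' : y⁻¹ * y⁻¹ = y := by rw [← mul_inv_rev, hyy, inv_inv]
  have hxi : x⁻¹ = x := inv_eq_of_mul_eq_one_left hx
  obtain ⟨a, ha⟩ : ∃ a, a = y * x * y⁻¹ := ⟨_, rfl⟩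
  obtain ⟨b, hb⟩ : ∃ b, b = y⁻¹ * x * y := ⟨_, rfl⟩
  have haa : a * a = 1 := by rw [ha, conj_mul, hx, mul_one, mul_inv_cancel]
  have hbb : b * b = 1 := by
    rw [hb]
    simp [mul_assoc, mul_mul_self_cancel hx]
  have hai : a⁻¹ = a := inv_eq_of_mul_eq_one_left haa
  have hbi : b⁻¹ = b := inv_eq_of_mul_eq_one_left hbb
  have hxab : x * a * b = 1 := by
    rw [← hxy, ha, hb]
    calc _ = x * y * x * (y⁻¹ * y⁻¹) * x * y := by simp only [mul_assoc]
      _ = x * y * x * y * x * y := by rw [hyy']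
      _ = _ := by simp only [pow_succ, pow_zero, one_mul, mul_assoc]
  have hax : a * x = b := by
    rw [← inv_inv (a * x), mul_inv_rev, hxi, hai, inv_eq_of_mul_eq_one_right hxab]
  have hxa : x * a = b := by rw [eq_inv_of_mul_eq_one_left hxab, hbi]
  have hxb : x * b = a := by rw [← hxa, mul_mul_self_cancel hx]
  have hab : a * b = x := by rw [← hax, mul_mul_self_cancel haa]
  have hba : b * a = x := by rw [← hxa, mul_assoc, haa, mul_one]
  have hbx : b * x = a := by rw [← hax, mul_assoc, hx, mul_one]
  have hyx : y * x * y⁻¹ = a := ha.symm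
  have hya : y * a * y⁻¹ = b := by
    rw [ha, hb]
    calc _ = (y * y) * x * (y⁻¹ * y⁻¹) := by simp only [mul_assoc]
      _ = _ := by rw [hyy, hyy']
  have hyb : y * b * y⁻¹ = x := by rw [hb]; simp [mul_assoc]
  have hxne : x ≠ a := by
    intro e
    rw [← e] at hyx
    exact hnc (mul_inv_eq_iff_eq_mul.1 hyx).symm
  have ha1 : a ≠ 1 := by
    rw [ha]
    simpa using hx1
  -- the Klein four-group generated by the conjugates of `x`
  let N : Subgroup G :=
    { carrier := {1, x, a, b}
      one_mem' := by simp
      mul_mem' := by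
        rintro u v (rfl | rfl | rfl | rfl) (rfl | rfl | rfl | rfl) <;>
          simp [hx, haa, hbb, hxa, hxb, hax, hab, hbx, hba]
      inv_mem' := by
        rintro u (rfl | rfl | rfl | rfl) <;> simp [hxi, hai, hbi] }
  have hNmem : ∀ u, u ∈ N ↔ u = 1 ∨ u = x ∨ u = a ∨ u = b := fun u => Iff.rfl
  have hNsq : ∀ u ∈ N, u * u = 1 := by
    rintro u (rfl | rfl | rfl | rfl)
    · exact one_mul 1
    · exact hx
    · exact haa
    · exact hbb
  have hNx : x ∈ N := by simp [hNmem]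
  have hNnormal : N.Normal := by
    rw [← Subgroup.normalizer_eq_top_iff, eq_top_iff, ← htop, Subgroup.closure_le]
    rintro g (rfl | rfl)
    · exact Subgroup.le_normalizer hNx
    · rw [SetLike.mem_coe, Subgroup.mem_normalizer_iff]
      intro u
      constructor
      · rintro (rfl | rfl | rfl | rfl)
        · simp [hNmem]
        · simp [hNmem, hyx]
        · simp [hNmem, hya]
        · simp [hNmem, hyb]
      · intro hu
        have hinj : ∀ v, g * u * g⁻¹ = g * v * g⁻¹ → u = v := fun v e =>
          mul_left_cancel (mul_right_cancel e)
        rcases hu with e | e | e | e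
        · exact Or.inl (hinj 1 (by simpa using e))
        · exact Or.inr (Or.inr (Or.inr (hinj b (e.trans hyb.symm))))
        · exact Or.inr (Or.inl (hinj x (e.trans hyx.symm)))
        · exact Or.inr (Or.inr (Or.inl (hinj a (e.trans hya.symm))))
  have hNcard : Nat.card N = 4 := by
    have hbne : b ≠ 1 := by
      intro e
      apply hx1
      rw [← hyb, e, mul_one, mul_inv_cancel]
    have hxb' : x ≠ b := fun e => ha1 (by rw [← hxb, ← e, hx])
    have hab' : a ≠ b := fun e => hx1 (by rw [← hab, ← e, haa])
    have : (N : Set G) = (({1, x, a, b} : Finset G) : Set G) := by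
      ext u
      simp [hNmem]
    rw [← SetLike.coe_sort_coe, this, Nat.card_coe_set_eq, Set.ncard_coe_finset,
      Finset.card_insert_of_notMem, Finset.card_insert_of_notMem, Finset.card_pair hab']
    · simp [hxne, hxb']
    · simp [hx1.symm, ha1.symm, hbne.symm]
  -- the points of the permutation representation are the four cosets of `⟨y⟩`
  obtain ⟨Q, hQ⟩ : ∃ Q, Q = Subgroup.zpowers y := ⟨_, rfl⟩
  have hyord : orderOf y = 3 := orderOf_eq_prime hy hy1
  have hQcube : ∀ u ∈ Q, u ^ 3 = 1 := by
    intro u hu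
    rw [hQ] at hu
    exact orderOf_dvd_iff_pow_eq_one.1 (hyord ▸ orderOf_dvd_of_mem_zpowers hu)
  have hNQ : ∀ u, u ∈ N → u ∈ Q → u = 1 := by
    intro u hN hQ'
    have h3 := hQcube u hQ'
    rwa [pow_succ, pow_two, hNsq u hN, one_mul] at h3
  have hcompl : Subgroup.IsComplement' N Q := by
    refine Subgroup.isComplement'_of_disjoint_and_mul_eq_univ
      (Subgroup.disjoint_def.2 fun {u} => hNQ u) ?_
    rw [← Subgroup.normal_mul, Subgroup.coe_eq_univ, eq_top_iff, ← htop, closure_pair_eq_sup, hQ]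
    exact sup_le_sup_right (by rwa [Subgroup.zpowers_le]) _
  have hindex : Q.index = 4 := hcompl.index_eq_card.trans hNcard
  have hcard : Nat.card G = 12 := by
    rw [← hcompl.card_mul_card, hNcard, hQ, Nat.card_zpowers, hyord]
  have hcore : (MulAction.toPermHom G (G ⧸ Q)).ker = ⊥ := by
    rw [← Subgroup.normalCore_eq_ker, eq_bot_iff]
    intro g hg
    have hgQ : g ∈ Q := Subgroup.normalCore_le Q hg
    have hxg : x * g * x⁻¹ ∈ Q := hg x
    -- the commutator of `x` and `g` lies in both `N` and `Q`
    have hcomm : x * (g * x⁻¹ * g⁻¹) = 1 := by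
      apply hNQ
      · exact mul_mem hNx (hNnormal.conj_mem _ (inv_mem hNx) g)
      · have : x * (g * x⁻¹ * g⁻¹) = x * g * x⁻¹ * g⁻¹ := by simp only [mul_assoc]
        rw [this]
        exact mul_mem hxg (inv_mem hgQ)
    have hc : Commute x g := by
      have : x * g * x⁻¹ * g⁻¹ = 1 := by rw [← hcomm]; simp only [mul_assoc]
      rw [mul_inv_eq_one, mul_inv_eq_iff_eq_mul] at this
      exact this
    rw [Subgroup.mem_bot]
    by_contra hg1
    have hgord : orderOf g = 3 := orderOf_eq_prime (hQcube g hgQ) hg1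
    have hyg : y ∈ Subgroup.zpowers g := by
      have hle : Subgroup.zpowers g ≤ Q := by rwa [Subgroup.zpowers_le]
      have : Subgroup.zpowers g = Q := by
        apply Subgroup.eq_of_le_of_card_ge hle
        rw [hQ, Nat.card_zpowers, Nat.card_zpowers, hgord, hyord]
      rw [this, hQ]
      exact Subgroup.mem_zpowers y
    obtain ⟨k, hk⟩ := hyg
    have hk' : g ^ k = y := hk
    exact hnc (hk' ▸ hc.zpow_right k)
  have hfour : Nat.card (G ⧸ Q) = 4 := hindex
  obtain ⟨e⟩ : Nonempty (G ⧸ Q ≃ Fin 4) := Finite.card_eq.1 (by rw [hfour, Nat.card_fin])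
  let φ : G →* Equiv.Perm (Fin 4) :=
    (Equiv.permCongrHom e).toMonoidHom.comp (MulAction.toPermHom G (G ⧸ Q))
  have hφ : Function.Injective φ :=
    (Equiv.permCongrHom e).injective.comp ((MonoidHom.ker_eq_bot_iff _).1 hcore)
  have hrange : φ.range = alternatingGroup (Fin 4) := by
    apply Equiv.Perm.eq_alternatingGroup_of_index_eq_two
    have h1 := φ.range.card_mul_index
    have h2 : Nat.card φ.range = 12 := by
      rw [← hcard]
      exact (Nat.card_congr (MonoidHom.ofInjective hφ).toEquiv).symm
    rw [h2, Nat.card_perm, Nat.card_fin] at h1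
    norm_num [Nat.factorial] at h1
    omega
  rw [← hrange]
  exact ⟨MonoidHom.ofInjective hφ⟩

theorem isListed_of_pairRelation [Finite G] {x y : G} (hx : x * x = 1) (hx1 : x ≠ 1)
    (h : PairRelation x y) : IsListed (Subgroup.closure ({x, y} : Set G)) := by
  have hx2 := orderOf_eq_two_of_mul_self hx hx1
  rcases h with ⟨hc, h⟩ | ⟨h1, h2⟩
  · have hn : orderOf y ∣ 4 ∨ orderOf y ∣ 6 := h.imp orderOf_dvd_of_pow_eq_one
      orderOf_dvd_of_pow_eq_one
    have hn' : orderOf y = 1 ∨ orderOf y = 2 ∨ orderOf y = 3 ∨ orderOf y = 4 ∨ orderOf y = 6 := by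
      have hle : orderOf y ≤ 6 := by
        rcases hn with h | h
        · exact (Nat.le_of_dvd (by norm_num) h).trans (by norm_num)
        · exact Nat.le_of_dvd (by norm_num) h
      have hpos := orderOf_pos y
      interval_cases orderOf y <;> omega
    by_cases hmem : x ∈ Subgroup.zpowers y
    · have hcl : Subgroup.closure ({x, y} : Set G) = Subgroup.zpowers y := by
        rw [closure_pair_eq_sup, sup_eq_right, Subgroup.zpowers_le]
        exact hmem
      have h2 := orderOf_dvd_of_mem_zpowers hmem
      rw [hx2] at h2
      rcases hn' with e | e | e | e | e
      · omega
      · exact Or.inl (nonempty_mulEquiv_of_closure_eq_zpowers hcl e)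
      · omega
      · exact Or.inr (Or.inr (Or.inl (nonempty_mulEquiv_of_closure_eq_zpowers hcl e)))
      · exact Or.inr (Or.inr (Or.inr (Or.inl (nonempty_mulEquiv_of_closure_eq_zpowers hcl e))))
    · rcases hn' with e | e | e | e | e
      · left
        rw [orderOf_eq_one_iff] at e
        refine nonempty_mulEquiv_of_closure_eq_zpowers (g := x) ?_ hx2
        rw [closure_pair_eq_sup, e, Subgroup.zpowers_one_eq_bot, sup_bot_eq]
      · exact Or.inr (Or.inl (nonempty_mulEquiv_prod hx2 hc hmem e))
      · refine Or.inr (Or.inr (Or.inr (Or.inl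
          (nonempty_mulEquiv_of_closure_eq_zpowers (g := x * y) ?_ ?_))))
        · apply le_antisymm
          · rw [closure_pair_eq_sup, sup_le_iff, Subgroup.zpowers_le, Subgroup.zpowers_le]
            have hy3 : y ^ 3 = 1 := e ▸ pow_orderOf_eq_one y
            have hx3 : (x * y) ^ 3 = x := by
              rw [hc.mul_pow, hy3, mul_one, pow_succ, pow_two, hx, one_mul]
            have hxm : x ∈ Subgroup.zpowers (x * y) := by
              have := Subgroup.npow_mem_zpowers (x * y) 3
              rwa [hx3] at this
            refine ⟨hxm, ?_⟩
            have := mul_mem hxm (Subgroup.mem_zpowers (x * y))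
            rwa [mul_mul_self_cancel hx] at this
          · rw [Subgroup.zpowers_le]
            exact mul_mem (Subgroup.subset_closure (by simp)) (Subgroup.subset_closure (by simp))
        · rw [hc.orderOf_mul_eq_mul_orderOf_of_coprime (by rw [hx2, e]; norm_num), hx2, e]
      · exact Or.inr (Or.inr (Or.inr (Or.inr (Or.inl (nonempty_mulEquiv_prod hx2 hc hmem e)))))
      · exact Or.inr (Or.inr (Or.inr (Or.inr (Or.inr (Or.inl
          (nonempty_mulEquiv_prod hx2 hc hmem e))))))
  · refine Or.inr (Or.inr (Or.inr (Or.inr (Or.inr (Or.inr ?_)))))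
    have hxm : x ∈ Subgroup.closure ({x, y} : Set G) := Subgroup.subset_closure (by simp)
    have hym : y ∈ Subgroup.closure ({x, y} : Set G) := Subgroup.subset_closure (by simp)
    refine nonempty_mulEquiv_alternatingGroup (x := ⟨x, hxm⟩) (y := ⟨y, hym⟩) (Subtype.ext hx)
      (fun e => hx1 (congrArg Subtype.val e)) (Subtype.ext h1) (Subtype.ext h2) ?_
    have := Subgroup.closure_closure_coe_preimage (k := ({x, y} : Set G))
    convert this using 2
    ext ⟨u, hu⟩
    simp [Subtype.ext_iff]

end PairRelations

/-! ### Integrality from the relations -/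

section Integrality

theorem exists_int_of_cubic {ν : ℝ} (h : ν ^ 3 = 4 * ν) : ∃ n : ℤ, ν = (n : ℝ) := by
  have : ν * ((ν - 2) * (ν + 2)) = 0 := by linear_combination h
  rcases mul_eq_zero.1 this with h | h
  · exact ⟨0, by simpa using h⟩
  rcases mul_eq_zero.1 h with h | h
  · exact ⟨2, by push_cast; linarith⟩
  · exact ⟨-2, by push_cast; linarith⟩

theorem exists_int_of_quartic {ν : ℝ} (h : ν ^ 4 = 5 * ν ^ 2 - 4) : ∃ n : ℤ, ν = (n : ℝ) := by
  have : ((ν - 1) * (ν + 1)) * ((ν - 2) * (ν + 2)) = 0 := by linear_combination h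
  rcases mul_eq_zero.1 this with h | h <;> rcases mul_eq_zero.1 h with h | h
  · exact ⟨1, by push_cast; linarith⟩
  · exact ⟨-1, by push_cast; linarith⟩
  · exact ⟨2, by push_cast; linarith⟩
  · exact ⟨-2, by push_cast; linarith⟩

/-- An eigenvector of `x + b`, where `x` is an involution commuting with `b`, projects to an
eigenvector of `b` in one of the two eigenspaces of `x`. -/
theorem exists_eigenvector_of_commute {A : Type*} [Ring A] [Algebra ℝ A] {x b f : A} {μ : ℝ}
    (hx : x * x = 1) (hxb : Commute x b) (hf : f ≠ 0) (h : (x + b) * f = μ • f) :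
    ∃ g : A, g ≠ 0 ∧ (b * g = (μ - 1) • g ∨ b * g = (μ + 1) • g) := by
  have hb : b * f = μ • f - x * f := by rw [← h, add_mul, add_sub_cancel_left]
  have hbx : b * (x * f) = μ • (x * f) - f := by
    rw [← mul_assoc, ← hxb.eq, mul_assoc, hb, mul_sub, mul_smul_comm, ← mul_assoc, hx, one_mul]
  by_cases hg : f + x * f = 0
  · refine ⟨f - x * f, ?_, Or.inr ?_⟩
    · intro h0
      apply hf
      have : (2 : ℝ) • f = 0 := by
        rw [two_smul]
        calc f + f = (f + x * f) + (f - x * f) := by abel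
          _ = 0 := by rw [hg, h0, add_zero]
      exact (smul_eq_zero.1 this).resolve_left two_ne_zero
    · rw [mul_sub, hb, hbx]
      module
  · refine ⟨f + x * f, hg, Or.inl ?_⟩
    rw [mul_add, hb, hbx]
    module

variable {G : Type*} [Group G]

theorem smul_eq_smul_cancel {f : MonoidAlgebra ℝ G} (hf : f ≠ 0) {a b : ℝ} (h : a • f = b • f) :
    a = b := by
  by_contra hab
  exact hf ((smul_eq_zero.1 (by rw [sub_smul, h, sub_self] : (a - b) • f = 0)).resolve_left
    (sub_ne_zero.2 hab))

theorem pow_apply_eigenvector {a f : MonoidAlgebra ℝ G} {ν : ℝ} (h : a * f = ν • f) (n : ℕ) :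
    a ^ n * f = ν ^ n • f := by
  induction n with
  | zero => simp
  | succ n ih => rw [pow_succ, mul_assoc, h, mul_smul_comm, ih, smul_smul, pow_succ, mul_comm]

/-- The eigenvalues of `y + y⁻¹` are integers if `y ^ 4 = 1` or `y ^ 6 = 1`. -/
theorem hasIntegralSpectrum_add_inv {y : G} (hy : y ^ 4 = 1 ∨ y ^ 6 = 1) :
    HasIntegralSpectrum (of ℝ G y + of ℝ G y⁻¹) := by
  intro ν g hg h
  have hp := pow_apply_eigenvector h
  rcases hy with hy | hy
  · have hY : of ℝ G y ^ 4 = 1 := by rw [← map_pow, hy, map_one]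
    have hi : y⁻¹ = y ^ 3 := inv_eq_of_mul_eq_one_left (by rw [← pow_succ, hy])
    have key : (of ℝ G y + of ℝ G y⁻¹) ^ 3 = 4 * (of ℝ G y + of ℝ G y⁻¹) := by
      rw [hi, map_pow]
      linear_combination (norm := noncomm_ring)
        (of ℝ G y ^ 5 + 3 * of ℝ G y ^ 3 + 4 * of ℝ G y) * hY
    refine exists_int_of_cubic (smul_eq_smul_cancel hg ?_)
    rw [← hp 3, key, mul_assoc, h, ← Nat.cast_ofNat (R := MonoidAlgebra ℝ G), ← nsmul_eq_mul]
    module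
  · have hY : of ℝ G y ^ 6 = 1 := by rw [← map_pow, hy, map_one]
    have hi : y⁻¹ = y ^ 5 := inv_eq_of_mul_eq_one_left (by rw [← pow_succ, hy])
    have key : (of ℝ G y + of ℝ G y⁻¹) ^ 4 = 5 * (of ℝ G y + of ℝ G y⁻¹) ^ 2 - 4 := by
      have h4 : (4 : MonoidAlgebra ℝ G) = 1 + 1 + 1 + 1 := by norm_num
      rw [hi, map_pow, h4]
      linear_combination (norm := noncomm_ring)
        (of ℝ G y ^ 14 + 4 * of ℝ G y ^ 10 + of ℝ G y ^ 8 + 6 * of ℝ G y ^ 6 - of ℝ G y ^ 4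
          + 5 * of ℝ G y ^ 2 - 1 - 1 - 1 - 1) * hY
    refine exists_int_of_quartic (smul_eq_smul_cancel hg ?_)
    rw [← hp 4, key, sub_mul, mul_assoc, hp 2, ← Nat.cast_ofNat (R := MonoidAlgebra ℝ G),
      ← Nat.cast_ofNat (R := MonoidAlgebra ℝ G) (n := 4), ← nsmul_eq_mul, ← nsmul_eq_mul]
    module

theorem HasIntegralSpectrum.involution_add {x : G} {b : MonoidAlgebra ℝ G}
    (hb : HasIntegralSpectrum b) (hx : x * x = 1) (hxb : Commute (of ℝ G x) b) :
    HasIntegralSpectrum (of ℝ G x + b) := by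
  intro μ f hf h
  obtain ⟨g, hg, e | e⟩ := exists_eigenvector_of_commute
    (by rw [← map_mul, hx, map_one]) hxb hf h
  · obtain ⟨n, hn⟩ := hb _ g hg e
    exact ⟨n + 1, by push_cast; linarith⟩
  · obtain ⟨n, hn⟩ := hb _ g hg e
    exact ⟨n - 1, by push_cast; linarith⟩

theorem hasIntegralSpectrum_zero : HasIntegralSpectrum (0 : MonoidAlgebra ℝ G) := by
  intro μ f hf h
  rw [zero_mul] at h
  exact ⟨0, by simpa using (smul_eq_zero.1 h.symm).resolve_right hf⟩

/-- The truncated tetrahedron: with `t = 1 + y + y⁻¹`, the relations give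
`t x t x t = 3 t + 2 t x t`, and an eigenvector `f` of `x + y + y⁻¹` is sent by `t` to an
eigenvector of `t x` or to zero. -/
theorem hasIntegralSpectrum_of_cube {x y : G} (hx : x * x = 1) (hy : y ^ 3 = 1)
    (hxy : (x * y) ^ 3 = 1) : HasIntegralSpectrum (of ℝ G x + of ℝ G y + of ℝ G y⁻¹) := by
  intro μ f hf h
  have hyy : y * y = y⁻¹ := eq_inv_of_mul_eq_one_left (by rw [← hy, pow_succ, pow_two])
  have hxi : x⁻¹ = x := inv_eq_of_mul_eq_one_left hx
  have hr1 : x * y * x = y⁻¹ * x * y⁻¹ := by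
    have : (x * y * x) * (y * x * y) = 1 := by
      rw [← hxy]
      simp only [pow_succ, pow_zero, one_mul, mul_assoc]
    rw [eq_inv_of_mul_eq_one_left this]
    simp only [mul_inv_rev, hxi, mul_assoc]
  have hr2 : x * y⁻¹ * x = y * x * y := by
    have := congrArg (·⁻¹) hr1
    simpa only [mul_inv_rev, hxi, inv_inv, ← mul_assoc] using this
  obtain ⟨X, hX⟩ : ∃ X, X = of ℝ G x := ⟨_, rfl⟩
  obtain ⟨Y, hY⟩ : ∃ Y, Y = of ℝ G y := ⟨_, rfl⟩
  obtain ⟨Z, hZ⟩ : ∃ Z, Z = of ℝ G y⁻¹ := ⟨_, rfl⟩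
  have hXX : X * X = 1 := by rw [hX, ← map_mul, hx, map_one]
  have hYY : Y * Y = Z := by rw [hY, hZ, ← map_mul, hyy]
  have hYZ : Y * Z = 1 := by rw [hY, hZ, ← map_mul, mul_inv_cancel, map_one]
  have hZY : Z * Y = 1 := by rw [hY, hZ, ← map_mul, inv_mul_cancel, map_one]
  have hZZ : Z * Z = Y := by rw [← hYY, mul_assoc, hYY, hYZ, mul_one]
  have hXYX : X * Y * X = Z * X * Z := by
    rw [hX, hY, hZ]
    simp only [← map_mul]
    rw [hr1]
  have hXZX : X * Z * X = Y * X * Y := by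
    rw [hX, hY, hZ]
    simp only [← map_mul]
    rw [hr2]
  obtain ⟨T, hT⟩ : ∃ T, T = 1 + Y + Z := ⟨_, rfl⟩
  have hTY : T * Y = T := by rw [hT, add_mul, add_mul, hYY, hZY]; noncomm_ring
  have hTZ : T * Z = T := by rw [hT, add_mul, add_mul, hZZ, hYZ]; noncomm_ring
  have hYT : Y * T = T := by rw [hT, mul_add, mul_add, hYY, hYZ]; noncomm_ring
  have hZT : Z * T = T := by rw [hT, mul_add, mul_add, hZZ, hZY]; noncomm_ring
  have hTT : T * T = (3 : ℝ) • T := by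
    nth_rewrite 1 [hT]
    rw [add_mul, add_mul, hYT, hZT, one_mul]
    module
  have hXTX : X * T * X = 1 + Z * X * Z + Y * X * Y := by
    rw [hT, mul_add, mul_add, add_mul, add_mul, hXYX, hXZX, mul_one, hXX]
  have hquad : T * (X * (T * (X * T))) = (3 : ℝ) • T + (2 : ℝ) • (T * (X * T)) := by
    have h1 : T * (X * (T * (X * T))) = T * (X * T * X) * T := by simp only [mul_assoc]
    have h2 : T * (Z * X * Z) * T = T * (X * T) := by
      rw [← mul_assoc, ← mul_assoc, hTZ, mul_assoc, hZT, mul_assoc]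
    have h3 : T * (Y * X * Y) * T = T * (X * T) := by
      rw [← mul_assoc, ← mul_assoc, hTY, mul_assoc, hYT, mul_assoc]
    rw [h1, hXTX, mul_add, mul_add, add_mul, add_mul, h2, h3, mul_one, hTT]
    module
  rw [← hX, ← hY, ← hZ] at h
  have hXf : X * f = (μ + 1) • f - T * f := by
    have : (X + Y + Z) * f = X * f + T * f - f := by rw [hT]; noncomm_ring
    rw [this] at h
    rw [add_smul, ← h]
    module
  have hXw : X * (T * f) = ((μ + 1) ^ 2 - 1) • f - (μ + 1) • (T * f) := by
    have h1 : X * (X * f) = f := by rw [← mul_assoc, hXX, one_mul]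
    rw [hXf, mul_sub, mul_smul_comm, hXf] at h1
    have h2 : X * (T * f) = (μ + 1) • ((μ + 1) • f - T * f) - f := by
      rw [sub_eq_iff_eq_add.1 h1, add_sub_cancel_left]
    rw [h2]
    module
  by_cases hw : T * f = 0
  · rw [hw, mul_zero, smul_zero, sub_zero] at hXw
    have h0 := (smul_eq_zero.1 hXw.symm).resolve_right hf
    have : μ * (μ + 2) = 0 := by linear_combination h0
    rcases mul_eq_zero.1 this with h | h
    · exact ⟨0, by simpa using h⟩
    · exact ⟨-2, by push_cast; linarith⟩
  · have hTXw : T * (X * (T * f)) = (μ ^ 2 - μ - 3) • (T * f) := by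
      rw [hXw, mul_sub, mul_smul_comm, mul_smul_comm, ← mul_assoc, hTT, smul_mul_assoc]
      module
    have h2 : T * (X * (T * (X * (T * f)))) =
        (3 : ℝ) • (T * f) + (2 : ℝ) • (T * (X * (T * f))) := by
      have := congrArg (· * f) hquad
      simpa only [mul_assoc, add_mul, smul_mul_assoc] using this
    rw [hTXw, mul_smul_comm, mul_smul_comm, hTXw, smul_smul, smul_smul, ← add_smul] at h2
    have h3 := smul_eq_smul_cancel hw h2
    have : ((μ - 3) * (μ + 2)) * ((μ - 2) * (μ + 1)) = 0 := by linear_combination h3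
    rcases mul_eq_zero.1 this with h | h <;> rcases mul_eq_zero.1 h with h | h
    · exact ⟨3, by push_cast; linarith⟩
    · exact ⟨-2, by push_cast; linarith⟩
    · exact ⟨2, by push_cast; linarith⟩
    · exact ⟨-1, by push_cast; linarith⟩

theorem hasIntegralSpectrum_of_pairRelation {x y : G} (hx : x * x = 1) (h : PairRelation x y) :
    HasIntegralSpectrum (of ℝ G x + of ℝ G y + of ℝ G y⁻¹) := by
  rcases h with ⟨hc, hy⟩ | ⟨h1, h2⟩
  · rw [add_assoc]
    exact (hasIntegralSpectrum_add_inv hy).involution_add hx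
      ((hc.map (of ℝ G)).add_right (hc.inv_right.map (of ℝ G)))
  · exact hasIntegralSpectrum_of_cube hx h1 h2

/-- Three commuting involutions are simultaneously diagonalizable with eigenvalues `±1`. -/
theorem hasIntegralSpectrum_of_commute {x y z : G} (hx : x * x = 1) (hy : y * y = 1)
    (hz : z * z = 1) (hxy : Commute x y) (hxz : Commute x z) (hyz : Commute y z) :
    HasIntegralSpectrum (of ℝ G x + of ℝ G y + of ℝ G z) := by
  have h1 := (hasIntegralSpectrum_zero (G := G)).involution_add hz (Commute.zero_right _)
  rw [add_zero] at h1
  rw [add_assoc]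
  exact (h1.involution_add hy (hyz.map (of ℝ G))).involution_add hx
    ((hxy.map (of ℝ G)).add_right (hxz.map (of ℝ G)))

/-- The complete bipartite graph: the three transpositions of the symmetric group satisfy
`a ^ 3 = 9 a` for their sum `a`. -/
theorem hasIntegralSpectrum_transpositions {x y z : G} (hx : x * x = 1) (hy : y * y = 1)
    (hz : z * z = 1) (h1 : x * y = y * z) (h2 : x * y = z * x) (h3 : y * x = x * z)
    (h4 : y * x = z * y) : HasIntegralSpectrum (of ℝ G x + of ℝ G y + of ℝ G z) := by
  intro μ f hf h
  have key : (of ℝ G x + of ℝ G y + of ℝ G z) ^ 3 =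
      (9 : ℝ) • (of ℝ G x + of ℝ G y + of ℝ G z) := by
    have hsq : (of ℝ G x + of ℝ G y + of ℝ G z) * (of ℝ G x + of ℝ G y + of ℝ G z) =
        (3 : ℝ) • (1 + of ℝ G (x * y) + of ℝ G (y * x)) := by
      simp only [mul_add, add_mul, ← map_mul, hx, hy, hz, ← h1, ← h2, ← h3, ← h4, map_one]
      module
    have e1 : x * (y * x) = z := by rw [h3, mul_mul_self_cancel hx]
    have e2 : y * (x * y) = z := by rw [h1, mul_mul_self_cancel hy]
    have e3 : z * (x * y) = x := by rw [h2, mul_mul_self_cancel hz]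
    have e4 : z * (y * x) = y := by rw [h4, mul_mul_self_cancel hz]
    rw [pow_succ', pow_two, hsq, mul_smul_comm]
    simp only [mul_add, add_mul, ← map_mul, mul_one, mul_mul_self_cancel hx,
      mul_mul_self_cancel hy, e1, e2, e3, e4]
    module
  have h9 := pow_apply_eigenvector h 3
  rw [key, smul_mul_assoc, h, smul_smul] at h9
  have := smul_eq_smul_cancel hf h9
  have : μ * ((μ - 3) * (μ + 3)) = 0 := by linear_combination -this
  rcases mul_eq_zero.1 this with h | h
  · exact ⟨0, by simpa using h⟩
  rcases mul_eq_zero.1 h with h | h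
  · exact ⟨3, by push_cast; linarith⟩
  · exact ⟨-3, by push_cast; linarith⟩

end Integrality

/-! ### Cubic connection sets -/

section ConnectionSets

variable {G : Type*} [Group G]

open Classical in
/-- A symmetric set of three elements consists of an involution and a pair of mutually inverse
elements, or of three involutions (the identity is not excluded here). -/
theorem symmetric_card_three {S : Finset G} (hS : (S : Set G)⁻¹ = S) (hc : S.card = 3) :
    (∃ x y : G, x * x = 1 ∧ y * y ≠ 1 ∧ x ∈ S ∧
      ∑ s ∈ S, of ℝ G s = of ℝ G x + of ℝ G y + of ℝ G y⁻¹) ∨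
    (∃ x y z : G, x * x = 1 ∧ y * y = 1 ∧ z * z = 1 ∧ x ≠ y ∧ x ≠ z ∧ y ≠ z ∧
      x ∈ S ∧ y ∈ S ∧ z ∈ S ∧ ∑ s ∈ S, of ℝ G s = of ℝ G x + of ℝ G y + of ℝ G z) := by
  have hinv : ∀ s ∈ S, s⁻¹ ∈ S := by
    intro s hs
    have : s⁻¹ ∈ (S : Set G) := by
      rw [← hS]
      simpa using hs
    exact this
  by_cases hall : ∀ s ∈ S, s * s = 1
  · right
    obtain ⟨x, y, z, hxy, hxz, hyz, rfl⟩ := Finset.card_eq_three.1 hc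
    refine ⟨x, y, z, hall x (by simp), hall y (by simp), hall z (by simp), hxy, hxz, hyz,
      by simp, by simp, by simp, ?_⟩
    rw [Finset.sum_insert (by simp [hxy, hxz]), Finset.sum_pair hyz, add_assoc]
  · left
    push Not at hall
    obtain ⟨y, hy, hyy⟩ := hall
    have hne : y ≠ y⁻¹ := fun e => hyy (by nth_rewrite 2 [e]; simp)
    have hsub : ({y, y⁻¹} : Finset G) ⊆ S := by
      intro u hu
      rcases Finset.mem_insert.1 hu with rfl | hu
      · exact hy
      · rw [Finset.mem_singleton.1 hu]
        exact hinv y hy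
    have hcard : (S \ {y, y⁻¹}).card = 1 := by
      rw [Finset.card_sdiff_of_subset hsub, hc, Finset.card_pair hne]
    obtain ⟨x, hx⟩ := Finset.card_eq_one.1 hcard
    have hxm : x ∈ S \ {y, y⁻¹} := by simp [hx]
    have hxi : x⁻¹ ∈ S \ {y, y⁻¹} := by
      simp only [Finset.mem_sdiff, Finset.mem_insert, Finset.mem_singleton, not_or] at hxm ⊢
      exact ⟨hinv x hxm.1, fun e => hxm.2.2 (by rw [← e, inv_inv]),
        fun e => hxm.2.1 (inv_injective e)⟩
    have hxx : x⁻¹ = x := by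
      rw [hx] at hxi
      simpa using hxi
    refine ⟨x, y, ?_, hyy, (Finset.mem_sdiff.1 hxm).1, ?_⟩
    · nth_rewrite 1 [← hxx]
      exact inv_mul_cancel x
    · rw [← Finset.sum_sdiff hsub, hx, Finset.sum_singleton, Finset.sum_pair hne, add_assoc]

theorem perm_three_pair (x y : Equiv.Perm (Fin 3)) (hx : x * x = 1) (hx1 : x ≠ 1)
    (hy : y * y ≠ 1) : y ^ 6 = 1 ∧ x * y = y⁻¹ * x := by
  have key : ∀ x y : Equiv.Perm (Fin 3), x * x = 1 → x ≠ 1 → y * y ≠ 1 →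
      y ^ 6 = 1 ∧ x * y = y⁻¹ * x := by
    decide +kernel
  exact key x y hx hx1 hy

theorem perm_three_triple (x y z : Equiv.Perm (Fin 3)) (hx : x * x = 1 ∧ x ≠ 1)
    (hy : y * y = 1 ∧ y ≠ 1) (hz : z * z = 1 ∧ z ≠ 1) (hxy : x ≠ y) (hxz : x ≠ z)
    (hyz : y ≠ z) : x * y = y * z := by
  have key : ∀ x : Equiv.Perm (Fin 3), x * x = 1 ∧ x ≠ 1 → ∀ y : Equiv.Perm (Fin 3),
      y * y = 1 ∧ y ≠ 1 → ∀ z : Equiv.Perm (Fin 3), z * z = 1 ∧ z ≠ 1 →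
        x ≠ y → x ≠ z → y ≠ z → x * y = y * z := by
    decide +kernel
  exact key x hx y hy z hz hxy hxz hyz

theorem allCayleyIntegral_of_isSymmThreeOrPairsListed [Fintype G]
    (h : IsSymmThreeOrPairsListed G) : AllCayleyIntegral 3 G := by
  intro S hS h1 hv
  rw [hasValency_cayleyGraph_iff] at hv
  obtain ⟨F, rfl⟩ := (Set.toFinite S).exists_finset_coe
  rw [isIntegralGraph_cayleyGraph_iff]
  have hne : ∀ s ∈ F, s ≠ 1 := by
    rintro s hs rfl
    exact h1 hs
  rcases symmetric_card_three hS (by simpa using hv) with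
    ⟨x, y, hx, hy, hxF, hsum⟩ | ⟨x, y, z, hx, hy, hz, hxy, hxz, hyz, hxF, hyF, hzF, hsum⟩
  · rw [hsum]
    have hx1 := hne x hxF
    rcases h with ⟨⟨e⟩⟩ | h
    · obtain ⟨hy6, hxy⟩ := perm_three_pair (e x) (e y) (by rw [← map_mul, hx, map_one])
        (by simpa using hx1)
        (fun h => hy (e.injective (by rw [map_mul, h, map_one])))
      have hy6' : y ^ 6 = 1 := e.injective (by rw [map_pow, hy6, map_one])
      have hxy' : x * y = y⁻¹ * x := e.injective (by rw [map_mul, hxy, map_mul, map_inv])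
      have hxy'' : x * y⁻¹ = y * x := by
        rw [mul_inv_eq_iff_eq_mul, mul_assoc, hxy', mul_inv_cancel_left]
      rw [add_assoc]
      refine (hasIntegralSpectrum_add_inv (Or.inr hy6')).involution_add hx ?_
      show _ * _ = _ * _
      rw [mul_add, add_mul, ← map_mul, ← map_mul, ← map_mul, ← map_mul, hxy', hxy'', add_comm]
    · exact hasIntegralSpectrum_of_pairRelation hx (pairRelation_of_isListed_closure
        (h x y (orderOf_eq_two_of_mul_self hx hx1)) hx)
  · rw [hsum]
    have hx1 := hne x hxF
    have hy1 := hne y hyF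
    have hz1 := hne z hzF
    rcases h with ⟨⟨e⟩⟩ | h
    · have key : ∀ u v w : G, u * u = 1 → u ≠ 1 → v * v = 1 → v ≠ 1 → w * w = 1 → w ≠ 1 →
          u ≠ v → u ≠ w → v ≠ w → u * v = v * w := by
        intro u v w hu hu1 hv hv1 hw hw1 huv huw hvw
        have hsq : ∀ t : G, t * t = 1 → t ≠ 1 → e t * e t = 1 ∧ e t ≠ 1 := fun t ht ht1 =>
          ⟨by rw [← map_mul, ht, map_one], by simpa using ht1⟩
        have := perm_three_triple (e u) (e v) (e w) (hsq u hu hu1) (hsq v hv hv1) (hsq w hw hw1)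
          (e.injective.ne huv) (e.injective.ne huw) (e.injective.ne hvw)
        exact e.injective (by rw [map_mul, this, map_mul])
      exact hasIntegralSpectrum_transpositions hx hy hz
        (key x y z hx hx1 hy hy1 hz hz1 hxy hxz hyz)
        (key z x y hz hz1 hx hx1 hy hy1 hxz.symm hyz.symm hxy).symm
        (key y x z hy hy1 hx hx1 hz hz1 hxy.symm hyz hxz)
        (key z y x hz hz1 hy hy1 hx hx1 hyz.symm hxz.symm hxy.symm).symm
    · have hcomm : ∀ u v : G, u * u = 1 → u ≠ 1 → v * v = 1 → v ≠ 1 → Commute u v := by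
        intro u v hu hu1 hv hv1
        rcases pairRelation_of_isListed_closure
          (h u v (orderOf_eq_two_of_mul_self hu hu1)) hu with ⟨hc, _⟩ | ⟨h3, _⟩
        · exact hc
        · rw [pow_succ, pow_two, hv, one_mul] at h3
          exact absurd h3 hv1
      exact hasIntegralSpectrum_of_commute hx hy hz (hcomm x y hx hx1 hy hy1)
        (hcomm x z hx hx1 hz hz1) (hcomm y z hy hy1 hz hz1)

theorem isSymmThreeOrPairsListed_of_allCayleyIntegral [Fintype G] (h : AllCayleyIntegral 3 G) :
    IsSymmThreeOrPairsListed G := by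
  by_cases hcomm : ∀ s t : G, s * s = 1 → t * t = 1 → Commute s t
  · right
    intro x y hx2
    have hx : x * x = 1 := by rw [← pow_two, ← hx2, pow_orderOf_eq_one]
    have hx1 : x ≠ 1 := by
      rintro rfl
      simp at hx2
    refine isListed_of_pairRelation hx hx1 ?_
    have hpow := pow_orderOf_eq_one y
    by_cases he : Even (orderOf y)
    · left
      rcases orderOf_of_even h he with e | e | e
      · rw [e] at hpow
        exact ⟨hcomm x y hx (by rw [← pow_two, hpow]), Or.inl (by
          rw [show 4 = 2 * 2 from rfl, pow_mul, hpow, one_pow])⟩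
      · rw [e] at hpow
        exact ⟨commute_of_pow_four h hcomm hx hpow, Or.inl hpow⟩
      · rw [e] at hpow
        exact ⟨commute_of_pow_six h hcomm hx e, Or.inr hpow⟩
    · rcases orderOf_of_odd h hcomm hx hx1 he with e | e
      · rw [orderOf_eq_one_iff] at e
        rw [e]
        exact Or.inl ⟨Commute.one_right x, Or.inl (one_pow 4)⟩
      · rw [e] at hpow
        by_cases hxy : Commute x y
        · exact Or.inl ⟨hxy, Or.inr (by rw [show 6 = 3 * 2 from rfl, pow_mul, hpow, one_pow])⟩
        · exact Or.inr ⟨hpow, mul_pow_three_eq_one h hcomm hx hpow hxy⟩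
  · left
    push Not at hcomm
    obtain ⟨x, y, hx, hy, hxy⟩ := hcomm
    exact nonempty_mulEquiv_perm_three h hx hy hxy

theorem hasCayleyOfValency_three_iff [Fintype G] :
    HasCayleyOfValency 3 G ↔ Even (Fintype.card G) ∧ 2 < Fintype.card G := by
  classical
  constructor
  · rintro ⟨S, hS, h1, hv⟩
    rw [hasValency_cayleyGraph_iff] at hv
    obtain ⟨F, rfl⟩ := (Set.toFinite S).exists_finset_coe
    have hc : F.card = 3 := by simpa using hv
    refine ⟨?_, ?_⟩
    · obtain ⟨x, hxF, hx⟩ : ∃ x ∈ F, x * x = 1 := by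
        rcases symmetric_card_three hS hc with
          ⟨x, y, hx, hy, hxF, hsum⟩ | ⟨x, y, z, hx, hy, hz, hxy, hxz, hyz, hxF, -⟩
        · exact ⟨x, hxF, hx⟩
        · exact ⟨x, hxF, hx⟩
      have hx1 : x ≠ 1 := by
        rintro rfl
        exact h1 hxF
      rw [even_iff_two_dvd, ← orderOf_eq_two_of_mul_self hx hx1]
      exact orderOf_dvd_card
    · have := Finset.card_le_univ F
      omega
  · rintro ⟨heven, hlt⟩
    obtain ⟨x, hx2⟩ := exists_prime_orderOf_dvd_card 2 (even_iff_two_dvd.1 heven)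
    have hx : x * x = 1 := by rw [← pow_two, ← hx2, pow_orderOf_eq_one]
    have hx1 : x ≠ 1 := by
      rintro rfl
      simp at hx2
    have hxi : x⁻¹ = x := inv_eq_of_mul_eq_one_left hx
    by_cases hall : ∀ y : G, y * y = 1
    · obtain ⟨m, hm⟩ := heven
      obtain ⟨F, hF, hFc⟩ := Finset.exists_subset_card_eq (s := Finset.univ.erase (1 : G)) (n := 3)
        (by rw [Finset.card_erase_of_mem (Finset.mem_univ 1), Finset.card_univ]; omega)
      refine ⟨F, ?_, fun h => (Finset.mem_erase.1 (hF h)).1 rfl,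
        (hasValency_cayleyGraph_iff _ _ _ _).2 (by simpa using hFc)⟩
      ext s
      rw [Set.mem_inv, inv_eq_of_mul_eq_one_left (hall s)]
    · push Not at hall
      obtain ⟨y, hy⟩ := hall
      have hyy : y ≠ y⁻¹ := fun e => hy (by nth_rewrite 2 [e]; simp)
      have hxy : x ≠ y := by rintro rfl; exact hy hx
      have hxy' : x ≠ y⁻¹ := fun e => hxy (by rw [← hxi, e, inv_inv])
      have hy1 : y ≠ 1 := by rintro rfl; simp at hy
      refine ⟨(({x, y, y⁻¹} : Finset G) : Set G), by simp [Set.inv_insert, hxi, Set.pair_comm],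
        by simp [hx1.symm, hy1.symm, hy1], (hasValency_cayleyGraph_iff _ _ _ _).2 ?_⟩
      rw [Set.ncard_coe_finset]
      exact Finset.card_eq_three.2 ⟨x, y, y⁻¹, hxy, hxy', hyy, rfl⟩

end ConnectionSets

theorem theorem2p6 (G : Type*) [Group G] [Fintype G] :
    (AllCayleyIntegral 3 G ↔ IsSymmThreeOrPairsListed G) ∧
    ((HasCayleyOfValency 3 G ∧ AllCayleyIntegral 3 G) ↔
      (Even (Fintype.card G) ∧ 2 < Fintype.card G ∧ IsSymmThreeOrPairsListed G)) := by
  have h : AllCayleyIntegral 3 G ↔ IsSymmThreeOrPairsListed G :=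
    ⟨isSymmThreeOrPairsListed_of_allCayleyIntegral, allCayleyIntegral_of_isSymmThreeOrPairsListed⟩
  exact ⟨h, by rw [h, hasCayleyOfValency_three_iff, and_assoc]⟩
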